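/- Let $d\ge 1$, let $\mathcal X\subset\mathbb R^d$ be a measurable set with the Euclidean metric $\rho$, and let $L>1$, $C>1$. For a probability $P$ on $\mathcal X\times\{0,1\}$ with marginal $P_X$ on $\mathcal X$ and regression function $\eta(x)=P(Y=1\mid X=x)$, write $P\in\mathcal P(\alpha,\beta)$ if * ($(\alpha,L)$-smoothness) $|\eta(x)-\eta(x')|\le L\,P_X\big(B(x,\rho(x,x'))\big)^{\alpha/d}$ for all $x,x'\in\mathrm{supp}(P_X)$, where $B$ denotes open balls, and * (Tsybakov noise) $P_X\big(|\eta(x)-\tfrac12|<t\big)<C\,t^{\beta}$ for all $0<t\le 1$. Let $R(f)=P(f(X)\ne Y)$ and $f^*=\mathbf 1_{\eta\ge 1/2}$. An active learner sees a pool of $w$ unlabelled points $X_1,\dots,X_w$, where $(X_1,Y_1),\dots,(X_w,Y_w)$ are i.i.d. from $P$. It adaptively requests labels of pool points, and then outputs a subset of the pool with (inferred) labels. Its classifier $\widehat f_{n,w}$ is the 1-nearest-neighbour classifier on this labelled subset. There is an active learner with inputs $\epsilon,\delta,n,w$ (and $d,L,C$), not depending on $\alpha$ or $\beta$, which always makes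 at most $n$ label requests, such that the following hold. 1. For every $\alpha\in(0,1)$ there are constants $K>0$ and $m\in\mathbb N$, depending only on $d,L,C,\alpha$, such that for all $\epsilon,\delta\in(0,\frac12)$ with $\alpha>2\epsilon$, all $\beta\in\big[\frac1{\log^2(1/\epsilon)},\log\frac1\epsilon\big]$ with $\alpha\beta\le d$, and all $n,w\in\mathbb N$: if $$n\ge K\Big(\log\tfrac1\epsilon\,\log\tfrac1\delta\Big)^m\Big(\frac1\epsilon\Big)^{\frac{2\alpha+d-\alpha\beta}{\alpha(\beta+1)}}\quad\text{and}\quad w\ge K\Big(\log\tfrac1\epsilon\,\log\tfrac1\delta\Big)^m\Big(\frac1\epsilon\Big)^{\frac{2\alpha+d}{\alpha(\beta+1)}},$$ then for every $P\in\mathcal P(\alpha,\beta)$, with probability at least $1-\delta$ over the pool, $R(\widehat f_{n,w})-R(f^*)\le\epsilon$. 2. (The same as a rate in $n$.) For all $\alpha\in(0,1)$ and $\beta>0$ with $\alpha\beta\le d$ there are constants $K>0$ and $m\in\mathbb N$, depending only on $d,L,C,\alpha,\beta$, such that for every $\delta\in(0,\frac12)$ and every sufficiently large $n$ there is an accuracy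 input $\epsilon\in(0,\frac12)$ such that, for every sufficiently large $w$ and every $P\in\mathcal P(\alpha,\beta)$, with probability at least $1-\delta$, $$R(\widehat f_{n,w})-R(f^*)\le K(\log n)^m\,n^{-\frac{\alpha(\beta+1)}{2\alpha+d-\alpha\beta}}.$$ -/

import Mathlib

open MeasureTheory

/-- The instance space `ℝ^d` with its Euclidean metric. -/
abbrev Inst (d : ℕ) : Type := EuclideanSpace ℝ (Fin d)

/-- `η` is (a version of) the regression function `η(x) = P(Y = 1 | X = x)` of `P`;
the label `1` is `true`. -/
structure IsRegressionFunction {d : ℕ} (P : Measure (Inst d × Bool)) (η : Inst d → ℝ) : Prop where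
  measurable : Measurable η
  mem_Icc : ∀ x, η x ∈ Set.Icc (0 : ℝ) 1
  condProb : ∀ A : Set (Inst d), MeasurableSet A →
    P (A ×ˢ {true}) = ∫⁻ x in A, ENNReal.ofReal (η x) ∂P.fst

/-- `(α, L)`-smoothness of the regression function with respect to the marginal `P_X`, on the
support of `P_X` in the data space `𝒳`:
`|η x - η x'| ≤ L * P_X (B (x, ρ (x, x'))) ^ (α / d)`, with open balls. -/
def IsSmoothRegression {d : ℕ} (𝒳 : Set (Inst d)) (PX : Measure (Inst d)) (η : Inst d → ℝ)
    (α L : ℝ) : Prop :=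
  ∀ x ∈ 𝒳 ∩ PX.support, ∀ x' ∈ 𝒳 ∩ PX.support,
    |η x - η x'| ≤ L * PX.real (Metric.ball x (dist x x')) ^ (α / (d : ℝ))

/-- Tsybakov's margin noise condition with parameters `β` and `C`. -/
def IsTsybakovNoise {d : ℕ} (PX : Measure (Inst d)) (η : Inst d → ℝ) (β C : ℝ) : Prop :=
  ∀ t : ℝ, 0 < t → t ≤ 1 → PX.real {x | |η x - 1 / 2| < t} < C * t ^ β

/-- `P` is a probability on `𝒳 × {0, 1}` with regression function `η`, it is `(α, L)`-smooth and
satisfies Tsybakov's noise condition with parameters `β` and `C`. -/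
structure SmoothNoiseClass {d : ℕ} (𝒳 : Set (Inst d)) (α L β C : ℝ)
    (P : Measure (Inst d × Bool)) (η : Inst d → ℝ) : Prop where
  isProbabilityMeasure : IsProbabilityMeasure P
  measurableSet : MeasurableSet 𝒳
  ae_mem : ∀ᵐ x ∂P.fst, x ∈ 𝒳
  regression : IsRegressionFunction P η
  smooth : IsSmoothRegression 𝒳 P.fst η α L
  noise : IsTsybakovNoise P.fst η β C

/-- The classification error `R(f) = P(f(X) ≠ Y)`. -/
noncomputable def risk {d : ℕ} (P : Measure (Inst d × Bool)) (f : Inst d → Bool) : ℝ :=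
  P.real {p | f p.1 ≠ p.2}

/-- The Bayes classifier `x ↦ 1_{η(x) ≥ 1/2}`. -/
noncomputable def bayesClassifier {d : ℕ} (η : Inst d → ℝ) (x : Inst d) : Bool :=
  open Classical in decide (1 / 2 ≤ η x)

/-- The excess risk `R(f) - R(f*)`. -/
noncomputable def excessRisk {d : ℕ} (P : Measure (Inst d × Bool)) (η : Inst d → ℝ)
    (f : Inst d → Bool) : ℝ :=
  risk P f - risk P (bayesClassifier η)

/-- What a deterministic active learner does with a pool of `w` points: either it stops and outputs
a labelled subset of the pool (`S i = some b` if the `i`-th point is kept with the label `b`,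
`S i = none` if it is left out), or it requests the label of the `i`-th pool point and goes on
according to the answer. -/
inductive Strategy (w : ℕ) : Type
  | output (S : Fin w → Option Bool) : Strategy w
  | request (i : Fin w) (next : Bool → Strategy w) : Strategy w

/-- The number of label requests made when the labels of the pool are `y`. -/
def Strategy.numRequests {w : ℕ} : Strategy w → (Fin w → Bool) → ℕ
  | .output _, _ => 0
  | .request i next, y => (next (y i)).numRequests y + 1

/-- The labelled set output when the labels of the pool are `y`. -/
def Strategy.activeSet {w : ℕ} : Strategy w → (Fin w → Bool) → (Fin w → Option Bool)
  | .output S, _ => S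
  | .request i next, y => (next (y i)).activeSet y

/-- An active learner with a pool of `w` points: it sees the unlabelled points of the pool, and the
labels only through its requests. -/
abbrev ActiveLearner (d w : ℕ) : Type := (Fin w → Inst d) → Strategy w

/-- The `i`-th pool point is a nearest neighbour of `z` among the points of the labelled set `S`. -/
def IsNearest {d w : ℕ} (x : Fin w → Inst d) (S : Fin w → Option Bool) (z : Inst d)
    (i : Fin w) : Prop :=
  S i ≠ none ∧ ∀ j, S j ≠ none → dist z (x i) ≤ dist z (x j)

/-- The 1-nearest-neighbour classifier on the labelled set `S` (ties go to the smallest index; if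
`S` is empty, the classifier is constantly `0`). -/
noncomputable def oneNN {d w : ℕ} (x : Fin w → Inst d) (S : Fin w → Option Bool)
    (z : Inst d) : Bool :=
  open Classical in
  decide (∃ i, IsNearest x S z i ∧ (∀ j < i, ¬ IsNearest x S z j) ∧ S i = some true)

/-- The classifier that the active learner `A` provides on the pool `D` of labelled points. -/
noncomputable def ActiveLearner.classifier {d w : ℕ} (A : ActiveLearner d w)
    (D : Fin w → Inst d × Bool) : Inst d → Bool :=
  oneNN (fun i => (D i).1) ((A fun i => (D i).1).activeSet fun i => (D i).2)

/-- Over the draw of an i.i.d. pool from `P`, the excess risk of the classifier of `A` is at most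
`ε` with probability at least `1 - δ` (the failure event has outer measure at most `δ`). -/
def ExcessRiskBound {d w : ℕ} (A : ActiveLearner d w) (P : Measure (Inst d × Bool))
    (η : Inst d → ℝ) (ε δ : ℝ) : Prop :=
  (Measure.pi fun _ : Fin w => P) {D | ε < excessRisk P η (A.classifier D)} ≤ ENNReal.ofReal δ

/-!
The learner works in levels `j = 1, …, J`, where level `j` is meant for points of margin
`|η - 1 / 2|` about `2 ^ (-j)`. The pool is cut into blocks: one of them only answers label
requests, and each level has a block of its own whose first points are the candidate centers. A
center of level `j` is covered if at some lower level its nearest neighbour in use is already known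
to be far from the decision boundary; then it is skipped at no cost. Otherwise, as long as a fixed
share of the budget `n` is not spent on the level, the labels of its `4 ^ j * Λ` nearest neighbours
in the label block are requested, and their average estimates `η` at the center up to `2 ^ (-j)`
times a constant. The output consists of the examined centers whose empirical margin is at least
`2 ^ (-j)`. None of this uses `α` or `β`.

Smoothness is measured by `P_X`-mass, so `η` differs by at most `2 ^ (-j) / 8` from its value at
the center of a ball of mass `q j`, about `2 ^ (-j d / α)`; its radius is `massRadius`. Hence about
`Λ / q j` points of level `j` form a net that has a point in the ball around any given point, and
the label block has `4 ^ j * Λ` points in the ball if the pool is large. Only points of margin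
`O(2 ^ (-j))` are not covered by the net of level `j - 1`, and there are `O(2 ^ (-j β) Λ / q j)` of
them in the net of level `j`, by the noise condition. Thus level `j` needs about
`2 ^ (j (2 + d / α - β))` labels, and its budget suffices up to the level `s` with `2 ^ (-s)` of
the order `ε ^ (1 / (β + 1))`. Deeper levels can run out of budget, but do no harm: what is not
covered by the net of level `s` has so small a margin that it is not the nearest output point of
any point that has to be classified correctly.

On a good pool (`Schedule.GoodPool`: the label averages concentrate, and the nets are dense and
contain few points of small margin), induction over the levels (`Schedule.net_in_use`) shows that
the nets up to level `s` are in use, and then every point `z` of margin at least `4 * 2 ^ (-s)` is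
classified correctly (`Schedule.oneNN_eq`): a net point of the level of `z` near `z` is in the
output, and every output point that is at least as near carries the right label. The remaining
points cost `O(2 ^ (-s (β + 1))) ≤ ε`. A pool is good with high probability by Chernoff, Hoeffding
and Markov bounds, which yields `Schedule.excessRiskBound_learner`. Choosing the parameters gives
`excessRiskBound_schedule` and `exists_sampleComplexity`; the rate in `n` follows by solving the
label complexity for `ε` (`exists_accuracy`).
-/

/-! ### The learner -/

section Learner

open scoped Classical

/-- The parameters of the learner for a pool of `w` points. The pool is cut into `J + 1` contiguous
blocks of equal size: block `0` only serves for label requests, and blocks `1, …, J` contain the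
candidate centers of the levels `1, …, J`. Only the first `M` points of a block are candidates. The
number `Λ` is the logarithmic factor in the number of label requests per center, and `n` is the
total label budget. -/
structure Schedule (w : ℕ) where
  J : ℕ
  M : ℕ
  Λ : ℕ
  n : ℕ

/-- The state of a pool point during the run of the learner: it is not used (`out`), or it was
found to be far from the decision boundary without label requests (`skipped`), or labels of its
nearest neighbours were requested, `t` of which were positive (`est t`). -/
inductive Status : Type
  | out : Status
  | skipped : Status
  | est (t : ℕ) : Status

namespace Schedule

variable {w d : ℕ} (p : Schedule w)

/-- The size of a block. -/
def size : ℕ := w / (p.J + 1)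

/-- The block of a pool index, which is its level. -/
def level (c : Fin w) : ℕ := c / p.size

/-- The position of a pool index in its block. -/
def pos (c : Fin w) : ℕ := c % p.size

/-- The pool indices that serve for label requests. -/
def labelBlock : Finset (Fin w) := Finset.univ.filter fun c => p.level c = 0

/-- The number of labels requested at a center of level `j`. -/
def labels (j : ℕ) : ℕ := 4 ^ j * p.Λ

/-- The number of centers of level `j` for which labels may be requested. -/
def budget (j : ℕ) : ℕ := p.n / (p.J * p.labels j)

/-- The candidate centers. -/
def IsCenter (c : Fin w) : Prop := 1 ≤ p.level c ∧ p.level c ≤ p.J ∧ p.pos c < p.M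

/-- The point `x i'` is closer to `z` than `x i`, with ties broken by the index. -/
def Closer (x : Fin w → Inst d) (z : Inst d) (i' i : Fin w) : Prop :=
  dist z (x i') < dist z (x i) ∨ (dist z (x i') = dist z (x i) ∧ i' < i)

/-- The `k` points of the label block that are nearest to `z`. -/
noncomputable def nearest (x : Fin w → Inst d) (z : Inst d) (k : ℕ) : Finset (Fin w) :=
  p.labelBlock.filter fun i => (p.labelBlock.filter fun i' => Closer x z i' i).card < k

/-- The empirical margin `|t / k - 1 / 2|` of a center of level `j` with `t` positive labels. -/
noncomputable def margin (j t : ℕ) : ℝ := |(t : ℝ) / p.labels j - 1 / 2|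

/-- A point of level `j` is resolved if it was skipped or if its empirical margin is at least
`3 * 2 ^ (-j)`: later points in its neighbourhood need no labels. -/
def Resolved (j : ℕ) (s : Status) : Prop :=
  s = .skipped ∨ ∃ t, s = .est t ∧ 3 * (1 / 2 : ℝ) ^ j ≤ p.margin j t

/-- At some lower level, a nearest neighbour of `x c` among the points in use is resolved. -/
def Covered (x : Fin w → Inst d) (σ : Fin w → Status) (c : Fin w) : Prop :=
  ∃ i, p.level i < p.level c ∧ p.Resolved (p.level i) (σ i) ∧
    ∀ i', p.level i' = p.level i → σ i' ≠ .out → dist (x c) (x i) ≤ dist (x c) (x i')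

/-- The points of level `j` for which labels were requested. -/
noncomputable def queried (σ : Fin w → Status) (j : ℕ) : Finset (Fin w) :=
  Finset.univ.filter fun c => p.level c = j ∧ ∃ t, σ c = .est t

/-- The labelled set that is output: the centers whose empirical margin at level `j` is at least
`2 ^ (-j)`, with the majority label of their neighbours. -/
noncomputable def outputSet (σ : Fin w → Status) (i : Fin w) : Option Bool :=
  match σ i with
  | .est t => if (1 / 2 : ℝ) ^ p.level i ≤ p.margin (p.level i) t then
      some (decide (1 / 2 ≤ (t : ℝ) / p.labels (p.level i))) else none
  | _ => none

/-- Request the labels of the points in a list and continue with the number of positive ones. -/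
def ask : List (Fin w) → (ℕ → Strategy w) → ℕ → Strategy w
  | [], next, t => next t
  | i :: l, next, t => .request i fun b => ask l next (t + b.toNat)

/-- The learner, with the candidates in the list still to be treated. -/
noncomputable def run (x : Fin w → Inst d) : List (Fin w) → (Fin w → Status) → Strategy w
  | [], σ => .output (p.outputSet σ)
  | c :: cs, σ =>
    if p.IsCenter c then
      if p.Covered x σ c then run x cs (Function.update σ c .skipped)
      else if (p.queried σ (p.level c)).card < p.budget (p.level c) then
        ask (p.nearest x (x c) (p.labels (p.level c))).toList
          (fun t => run x cs (Function.update σ c (.est t))) 0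
      else run x cs σ
    else run x cs σ

/-- The final state of the learner when the labels of the pool are `y`. -/
noncomputable def final (x : Fin w → Inst d) (y : Fin w → Bool) :
    List (Fin w) → (Fin w → Status) → (Fin w → Status)
  | [], σ => σ
  | c :: cs, σ => final x y cs
    (if p.IsCenter c then
      if p.Covered x σ c then Function.update σ c .skipped
      else if (p.queried σ (p.level c)).card < p.budget (p.level c) then
        Function.update σ c (.est
          ((p.nearest x (x c) (p.labels (p.level c))).filter fun i => y i = true).card)
      else σ
    else σ)

/-- The active learner with the parameters `p`. -/
noncomputable def learner (d : ℕ) : ActiveLearner d w :=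
  fun x => p.run x (List.finRange w) fun _ => .out

theorem activeSet_ask (y : Fin w → Bool) (l : List (Fin w)) (next : ℕ → Strategy w) (t : ℕ) :
    (ask l next t).activeSet y = (next (t + l.countP fun i => y i)).activeSet y := by
  induction l generalizing t with
  | nil => simp [ask]
  | cons i l ih =>
    simp only [ask, Strategy.activeSet, ih, List.countP_cons]
    cases y i <;> simp [add_assoc, add_comm 1]

theorem numRequests_ask (y : Fin w → Bool) (l : List (Fin w)) (next : ℕ → Strategy w) (t : ℕ) :
    (ask l next t).numRequests y =
      (next (t + l.countP fun i => y i)).numRequests y + l.length := by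
  induction l generalizing t with
  | nil => simp [ask]
  | cons i l ih =>
    simp only [ask, Strategy.numRequests, ih, List.countP_cons, List.length_cons]
    cases y i <;> simp [add_assoc, add_comm 1]

theorem countP_toList (y : Fin w → Bool) (s : Finset (Fin w)) :
    (s.toList.countP fun i => y i) = (s.filter fun i => y i = true).card := by
  rw [Finset.card_def, Finset.filter_val, ← Multiset.countP_eq_card_filter, ← Finset.coe_toList s,
    Multiset.coe_countP]
  simp

theorem activeSet_run (x : Fin w → Inst d) (y : Fin w → Bool) (cs : List (Fin w))
    (σ : Fin w → Status) :
    (p.run x cs σ).activeSet y = p.outputSet (p.final x y cs σ) := by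
  induction cs generalizing σ with
  | nil => simp [run, final, Strategy.activeSet]
  | cons c cs ih =>
    simp only [run, final]
    split_ifs <;> simp [ih, activeSet_ask, countP_toList]

theorem closer_iff (x : Fin w → Inst d) (z : Inst d) (i' i : Fin w) :
    Closer x z i' i ↔ toLex (dist z (x i'), i') < toLex (dist z (x i), i) := by
  rw [Prod.Lex.toLex_lt_toLex]; rfl

/-- Exactly `k` elements of a finite set have rank less than `k`. -/
theorem card_filter_rank_lt {ι κ : Type*} [LinearOrder κ] (s : Finset ι) (f : ι → κ)
    (hf : Function.Injective f) (k : ℕ) :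
    (s.filter fun i => (s.filter fun i' => f i' < f i).card < k).card = min k s.card := by
  have hmono : ∀ i ∈ s, ∀ j ∈ s, f i < f j →
      (s.filter fun i' => f i' < f i).card < (s.filter fun i' => f i' < f j).card := by
    intro i hi j _ hij
    apply Finset.card_lt_card
    refine (Finset.ssubset_iff_of_subset ?_).2 ⟨i, by simp [hi, hij], by simp⟩
    intro a ha
    simp only [Finset.mem_filter] at ha ⊢
    exact ⟨ha.1, ha.2.trans hij⟩
  have hinj : Set.InjOn (fun i => (s.filter fun i' => f i' < f i).card) s := by
    intro i hi j hj hij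
    rcases lt_trichotomy (f i) (f j) with h | h | h
    · exact absurd hij (hmono i hi j hj h).ne
    · exact hf h
    · exact absurd hij (hmono j hj i hi h).ne'
  have himg : s.image (fun i => (s.filter fun i' => f i' < f i).card) = Finset.range s.card := by
    apply Finset.eq_of_subset_of_card_le
    · intro a ha
      obtain ⟨i, hi, rfl⟩ := Finset.mem_image.1 ha
      refine Finset.mem_range.2 (Finset.card_lt_card ?_)
      exact (Finset.ssubset_iff_of_subset (Finset.filter_subset _ _)).2 ⟨i, hi, by simp⟩
    · rw [Finset.card_image_of_injOn hinj, Finset.card_range]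
  have := Finset.card_image_of_injOn (hinj.mono (by
    exact_mod_cast Finset.filter_subset
      (fun i => (s.filter fun i' => f i' < f i).card < k) s))
  rw [← this]
  have h2 : (s.filter fun i => (s.filter fun i' => f i' < f i).card < k).image
      (fun i => (s.filter fun i' => f i' < f i).card) = Finset.range (min k s.card) := by
    rw [← Finset.filter_image (p := fun a => a < k), himg]
    ext a; simp [and_comm]
  rw [h2, Finset.card_range]

theorem card_nearest (x : Fin w → Inst d) (z : Inst d) (k : ℕ) :
    (p.nearest x z k).card = min k p.labelBlock.card := by
  unfold nearest
  simp only [closer_iff]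
  refine card_filter_rank_lt _ (fun i => toLex (dist z (x i), i)) ?_ k
  intro i j hij
  simpa using congrArg (fun a => (ofLex a).2) hij

/-- If a closed ball around `z` contains `k` points of the label block, then it contains the
`k` nearest ones. -/
theorem dist_le_of_mem_nearest {x : Fin w → Inst d} {z : Inst d} {k : ℕ} {r : ℝ}
    (h : k ≤ (p.labelBlock.filter fun i => dist z (x i) ≤ r).card) {i : Fin w}
    (hi : i ∈ p.nearest x z k) : dist z (x i) ≤ r := by
  by_contra! hr
  have hi' := (Finset.mem_filter.1 hi).2
  refine absurd hi' (not_lt.2 (h.trans (Finset.card_le_card ?_)))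
  intro a ha
  simp only [Finset.mem_filter] at ha ⊢
  exact ⟨ha.1, Or.inl (ha.2.trans_lt hr)⟩

theorem queried_update_of_ne {σ : Fin w → Status} {c : Fin w} {s : Status} (j : ℕ)
    (hc : σ c = .out) (hs : ∀ t, s ≠ .est t) :
    p.queried (Function.update σ c s) j = p.queried σ j := by
  ext i
  simp only [queried, Finset.mem_filter, Finset.mem_univ, true_and]
  by_cases h : i = c
  · subst h; simp [hc, hs]
  · simp [Function.update_of_ne h]

theorem queried_update_est {σ : Fin w → Status} {c : Fin w} (t j : ℕ) (hc : σ c = .out) :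
    (p.queried (Function.update σ c (.est t)) j).card =
      (p.queried σ j).card + if j = p.level c then 1 else 0 := by
  split_ifs with hj
  · subst hj
    have : p.queried (Function.update σ c (.est t)) (p.level c) =
        insert c (p.queried σ (p.level c)) := by
      ext i
      simp only [queried, Finset.mem_filter, Finset.mem_univ, true_and, Finset.mem_insert]
      by_cases h : i = c
      · subst h; simp
      · simp [h]
    rw [this, Finset.card_insert_of_notMem]
    simp [queried, hc]
  · rw [add_zero]
    congr 1
    ext i
    simp only [queried, Finset.mem_filter, Finset.mem_univ, true_and]
    by_cases h : i = c
    · subst h; simp [Ne.symm hj]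
    · simp [Function.update_of_ne h]

/-- The requests that are still to be made fit into what is left of the budgets of the levels. -/
theorem numRequests_run_le (x : Fin w → Inst d) (y : Fin w → Bool) (cs : List (Fin w))
    (σ : Fin w → Status) (hnd : cs.Nodup) (hσ : ∀ c ∈ cs, σ c = .out) :
    (p.run x cs σ).numRequests y ≤
      ∑ j ∈ Finset.Icc 1 p.J, (p.budget j - (p.queried σ j).card) * p.labels j := by
  induction cs generalizing σ with
  | nil => simp [run, Strategy.numRequests]
  | cons c cs ih =>
    have hc : σ c = .out := hσ c (by simp)
    have hcs : c ∉ cs := (List.nodup_cons.1 hnd).1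
    have hnd' := (List.nodup_cons.1 hnd).2
    have hupd : ∀ s, ∀ c' ∈ cs, Function.update σ c s c' = .out := by
      intro s c' hc'
      rw [Function.update_of_ne (by rintro rfl; exact hcs hc')]
      exact hσ c' (by simp [hc'])
    have hσ' : ∀ c' ∈ cs, σ c' = .out := fun c' hc' => hσ c' (by simp [hc'])
    simp only [run]
    split_ifs with h1 h2 h3
    · refine (ih _ hnd' (hupd _)).trans (le_of_eq ?_)
      refine Finset.sum_congr rfl fun j _ => ?_
      rw [p.queried_update_of_ne j hc (by simp)]
    · rw [numRequests_ask, Finset.length_toList]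
      refine (Nat.add_le_add (ih _ hnd' (hupd _))
        ((p.card_nearest x (x c) _).trans_le (min_le_left _ _))).trans ?_
      have hmem : p.level c ∈ Finset.Icc 1 p.J := Finset.mem_Icc.2 ⟨h1.1, h1.2.1⟩
      rw [← Finset.add_sum_erase _ _ hmem, ← Finset.add_sum_erase _ _ hmem,
        p.queried_update_est _ _ hc, if_pos rfl]
      have : ∑ j ∈ (Finset.Icc 1 p.J).erase (p.level c),
          (p.budget j - (p.queried (Function.update σ c (.est (0 + (p.nearest x (x c)
            (p.labels (p.level c))).toList.countP fun i => y i))) j).card) * p.labels j =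
          ∑ j ∈ (Finset.Icc 1 p.J).erase (p.level c),
            (p.budget j - (p.queried σ j).card) * p.labels j := by
        refine Finset.sum_congr rfl fun j hj => ?_
        rw [p.queried_update_est _ _ hc, if_neg (Finset.ne_of_mem_erase hj), add_zero]
      rw [this]
      obtain ⟨a, ha⟩ := Nat.exists_eq_add_of_lt h3
      rw [ha]
      have e1 : (p.queried σ (p.level c)).card + a + 1 - ((p.queried σ (p.level c)).card + 1)
        = a := by omega
      have e2 : (p.queried σ (p.level c)).card + a + 1 - (p.queried σ (p.level c)).card
        = a + 1 := by omega
      rw [e1, e2]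
      nlinarith
    · exact ih _ hnd' hσ'
    · exact ih _ hnd' hσ'

theorem numRequests_learner_le (x : Fin w → Inst d) (y : Fin w → Bool) :
    ((p.learner d) x).numRequests y ≤ p.n := by
  refine (p.numRequests_run_le x y _ _ (List.nodup_finRange w) fun _ _ => rfl).trans ?_
  have h : ∀ j ∈ Finset.Icc 1 p.J,
      (p.budget j - (p.queried (fun _ => Status.out) j).card) * p.labels j ≤ p.n / p.J := by
    intro j _
    refine (Nat.mul_le_mul_right _ (Nat.sub_le _ _)).trans ?_
    rw [budget, ← Nat.div_div_eq_div_mul]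
    exact Nat.div_mul_le_self _ _
  refine (Finset.sum_le_card_nsmul _ _ _ h).trans ?_
  simpa using Nat.mul_div_le p.n p.J

end Schedule

end Learner

/-! ### The run of the learner -/

section Run

open scoped Classical

namespace Schedule

variable {w d : ℕ} (p : Schedule w)

theorem level_mono {c c' : Fin w} (h : c ≤ c') : p.level c ≤ p.level c' :=
  Nat.div_le_div_right h

theorem covered_congr {x : Fin w → Inst d} {σ σ' : Fin w → Status} {c : Fin w}
    (h : ∀ i, p.level i < p.level c → σ i = σ' i) : p.Covered x σ c ↔ p.Covered x σ' c := by
  refine exists_congr fun i => and_congr_right fun hi => ?_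
  rw [h i hi]
  refine and_congr_right fun _ => forall_congr' fun i' => imp_congr_right fun hi' => ?_
  rw [h i' (hi' ▸ hi)]

/-- What the state `σ` of the learner says about the points that have been treated, that is, those
that are not in the list `cs`. -/
structure Consistent (x : Fin w → Inst d) (y : Fin w → Bool) (cs : List (Fin w))
    (σ : Fin w → Status) : Prop where
  out : ∀ c ∈ cs, σ c = .out
  covered : ∀ c, σ c = .skipped → p.Covered x σ c
  skipped : ∀ c, c ∉ cs → p.IsCenter c → p.Covered x σ c → σ c = .skipped
  est : ∀ c t, σ c = .est t →
    t = ((p.nearest x (x c) (p.labels (p.level c))).filter fun i => y i = true).card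
  budget : ∀ c, c ∉ cs → p.IsCenter c → σ c = .out →
    p.budget (p.level c) ≤ ((p.queried σ (p.level c)).filter fun c' => c' < c).card
  center : ∀ c, σ c ≠ .out → p.IsCenter c

theorem consistent_final (x : Fin w → Inst d) (y : Fin w → Bool) (cs : List (Fin w))
    (σ : Fin w → Status) (hs : cs.Pairwise (· < ·)) (hcs : ∀ c ∉ cs, ∀ c' ∈ cs, c < c')
    (h : p.Consistent x y cs σ) : p.Consistent x y [] (p.final x y cs σ) := by
  induction cs generalizing σ with
  | nil => exact h
  | cons c cs ih =>
    have hs' := (List.pairwise_cons.1 hs).2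
    have hlt : ∀ a ∈ cs, c < a := (List.pairwise_cons.1 hs).1
    have hc : σ c = .out := h.out c (by simp)
    have hccs : c ∉ cs := fun hm => lt_irrefl _ (hlt c hm)
    have hnot : ∀ a ∉ cs, a = c ∨ a ∉ c :: cs := by
      intro a ha
      by_cases hac : a = c
      · exact Or.inl hac
      · exact Or.inr (by simp [hac, ha])
    have hcs' : ∀ a ∉ cs, ∀ a' ∈ cs, a < a' := by
      intro a ha a' ha'
      rcases hnot a ha with rfl | ha
      · exact hlt a' ha'
      · exact hcs a ha a' (by simp [ha'])
    -- The points whose level is at most that of `c` do not see the new status of `c`.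
    have hcov : ∀ s a, p.level a ≤ p.level c →
        (p.Covered x (Function.update σ c s) a ↔ p.Covered x σ a) := by
      intro s a ha
      refine p.covered_congr fun i hi => Function.update_of_ne ?_ _ _
      rintro rfl
      exact absurd hi (not_lt.2 ha)
    have hlev : ∀ a ∉ cs, p.level a ≤ p.level c := by
      intro a ha
      rcases hnot a ha with rfl | ha
      · exact le_rfl
      · exact p.level_mono (hcs a ha c (by simp)).le
    have hout : ∀ s, ∀ a ∈ cs, Function.update σ c s a = .out := by
      intro s a ha
      rw [Function.update_of_ne (by rintro rfl; exact hccs ha)]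
      exact h.out a (by simp [ha])
    have houtσ : ∀ a ∈ cs, σ a = .out := fun a ha => h.out a (by simp [ha])
    have hne : ∀ a, a ∉ c :: cs → a ≠ c := by rintro a ha rfl; simp at ha
    rw [final]
    apply ih _ hs' hcs'
    split_ifs with h1 h2 h3
    · -- `c` becomes skipped
      refine ⟨hout _, ?_, ?_, ?_, ?_, ?_⟩
      · intro a ha
        have hacs : a ∉ cs := fun hm => by simp [hout _ a hm] at ha
        rw [hcov _ a (hlev a hacs)]
        by_cases hac : a = c
        · exact hac ▸ h2
        · rw [Function.update_of_ne hac] at ha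
          exact h.covered a ha
      · intro a ha hca hcova
        rcases hnot a ha with rfl | ha'
        · simp
        · rw [hcov _ a (hlev a ha)] at hcova
          rw [Function.update_of_ne (hne a ha')]
          exact h.skipped a ha' hca hcova
      · intro a t ha
        by_cases hac : a = c
        · subst hac; simp at ha
        · rw [Function.update_of_ne hac] at ha
          exact h.est a t ha
      · intro a ha hca hoa
        rcases hnot a ha with rfl | ha'
        · simp at hoa
        · rw [Function.update_of_ne (hne a ha')] at hoa
          rw [p.queried_update_of_ne _ hc (by simp)]
          exact h.budget a ha' hca hoa
      · intro a ha
        by_cases hac : a = c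
        · exact hac ▸ h1
        · rw [Function.update_of_ne hac] at ha
          exact h.center a ha
    · -- the labels at `c` are requested
      refine ⟨hout _, ?_, ?_, ?_, ?_, ?_⟩
      · intro a ha
        have hacs : a ∉ cs := fun hm => by simp [hout _ a hm] at ha
        rw [hcov _ a (hlev a hacs)]
        by_cases hac : a = c
        · subst hac; simp at ha
        · rw [Function.update_of_ne hac] at ha
          exact h.covered a ha
      · intro a ha hca hcova
        rw [hcov _ a (hlev a ha)] at hcova
        rcases hnot a ha with rfl | ha'
        · exact absurd hcova h2
        · rw [Function.update_of_ne (hne a ha')]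
          exact h.skipped a ha' hca hcova
      · intro a t ha
        by_cases hac : a = c
        · subst hac
          rw [Function.update_self] at ha
          exact (Status.est.inj ha).symm
        · rw [Function.update_of_ne hac] at ha
          exact h.est a t ha
      · intro a ha hca hoa
        rcases hnot a ha with rfl | ha'
        · simp at hoa
        · rw [Function.update_of_ne (hne a ha')] at hoa
          refine (h.budget a ha' hca hoa).trans (Finset.card_le_card ?_)
          refine Finset.filter_subset_filter _ ?_
          intro i hi
          simp only [queried, Finset.mem_filter, Finset.mem_univ, true_and] at hi ⊢
          refine ⟨hi.1, ?_⟩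
          by_cases hic : i = c
          · subst hic; simp
          · rw [Function.update_of_ne hic]; exact hi.2
      · intro a ha
        by_cases hac : a = c
        · exact hac ▸ h1
        · rw [Function.update_of_ne hac] at ha
          exact h.center a ha
    · -- the budget of the level of `c` is exhausted
      refine ⟨houtσ, h.covered, ?_, h.est, ?_, h.center⟩
      · intro a ha hca hcova
        rcases hnot a ha with rfl | ha'
        · exact absurd hcova h2
        · exact h.skipped a ha' hca hcova
      · intro a ha hca hoa
        rcases hnot a ha with rfl | ha'
        · refine (not_lt.1 h3).trans (Finset.card_le_card ?_)
          intro i hi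
          refine Finset.mem_filter.2 ⟨hi, hcs i (fun hm => ?_) a (by simp)⟩
          obtain ⟨t, ht⟩ := (Finset.mem_filter.1 hi).2.2
          simp [h.out i hm] at ht
        · exact h.budget a ha' hca hoa
    · -- `c` is not a candidate
      refine ⟨houtσ, h.covered, ?_, h.est, ?_, h.center⟩
      · intro a ha hca hcova
        rcases hnot a ha with rfl | ha'
        · exact absurd hca h1
        · exact h.skipped a ha' hca hcova
      · intro a ha hca hoa
        rcases hnot a ha with rfl | ha'
        · exact absurd hca h1
        · exact h.budget a ha' hca hoa

/-- The final state of the learner satisfies its defining recursion. -/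
theorem consistent_finRange (x : Fin w → Inst d) (y : Fin w → Bool) :
    p.Consistent x y [] (p.final x y (List.finRange w) fun _ => .out) := by
  refine p.consistent_final x y _ _ (List.pairwise_lt_finRange w)
    (fun c hc => absurd (List.mem_finRange c) hc) ⟨fun _ _ => rfl, ?_, ?_, ?_, ?_, ?_⟩
  · intro c h; simp at h
  · intro c hc; exact absurd (List.mem_finRange c) hc
  · intro c t h; simp at h
  · intro c hc; exact absurd (List.mem_finRange c) hc
  · intro c h; simp at h

end Schedule
end Run

/-! ### Correctness of the learner on a good pool -/

section Correctness

open scoped Classical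

namespace Schedule

variable {w d : ℕ} (p : Schedule w)

/-- The assumptions on the regression function `η` and on the scales `r j` of the levels
`j = 1, …, s`: on the set `G`, the function `η` varies by at most `2 ^ (-j) / 8` within the radius
`r j`. Of each level, the first `T j` points are candidates. -/
structure Regular (η : Inst d → ℝ) (G : Set (Inst d)) (r : ℕ → Inst d → ℝ) (s : ℕ)
    (T : ℕ → ℕ) : Prop where
  mem_Icc : ∀ z, η z ∈ Set.Icc (0 : ℝ) 1
  smooth : ∀ j, 1 ≤ j → j ≤ s → ∀ z ∈ G, ∀ z' ∈ G, dist z z' ≤ r j z →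
    |η z - η z'| ≤ (1 / 2 : ℝ) ^ j / 8
  one_le : 1 ≤ s
  le_J : s ≤ p.J
  le_M : ∀ j, 1 ≤ j → j ≤ s → T j ≤ p.M
  pos : 0 < p.Λ

/-- The first `T j` points of level `j` have an element within the radius `r j z` of `z`. -/
def Near (x : Fin w → Inst d) (r : ℕ → Inst d → ℝ) (T : ℕ → ℕ) (j : ℕ) (z : Inst d) : Prop :=
  ∃ i, p.level i = j ∧ p.pos i < T j ∧ dist z (x i) ≤ r j z

/-- The good event: the label averages at all centers are close to their means, the label block is
dense around all centers at the scale `r s`, the first `T j` points of level `j` form a net at the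
scale `r j` for the centers of higher levels, and few of them have a small margin. -/
structure GoodPool (x : Fin w → Inst d) (y : Fin w → Bool) (η : Inst d → ℝ) (G : Set (Inst d))
    (r : ℕ → Inst d → ℝ) (s : ℕ) (T : ℕ → ℕ) : Prop where
  mem : ∀ i, x i ∈ G
  noise : ∀ c, p.IsCenter c →
    |(((p.nearest x (x c) (p.labels (p.level c))).filter fun i => y i = true).card : ℝ) -
      ∑ i ∈ p.nearest x (x c) (p.labels (p.level c)), η (x i)| ≤
        p.labels (p.level c) * ((1 / 2 : ℝ) ^ p.level c / 8)
  dense : ∀ c, p.IsCenter c →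
    p.labels s ≤ (p.labelBlock.filter fun i => dist (x c) (x i) ≤ r s (x c)).card
  cover : ∀ c, p.IsCenter c → ∀ j, 1 ≤ j → j ≤ s → j < p.level c → p.Near x r T j (x c)
  few : ∀ j, 1 ≤ j → j ≤ s →
    (Finset.univ.filter fun i => (p.level i = j ∧ p.pos i < T j) ∧
      |η (x i) - 1 / 2| < 7 * (1 / 2 : ℝ) ^ j).card ≤ p.budget j

section

variable {p} {x : Fin w → Inst d} {y : Fin w → Bool} {η : Inst d → ℝ} {G : Set (Inst d)}
  {r : ℕ → Inst d → ℝ} {s : ℕ} {T : ℕ → ℕ} {σ : Fin w → Status}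

theorem labels_pos (hr : 0 < p.Λ) (j : ℕ) : (0 : ℝ) < p.labels j := by
  unfold labels; positivity

/-- At a center of level at most `s`, the empirical mean is within `2 ^ (-level) / 4` of `η`. -/
theorem abs_est_sub_le (hr : p.Regular η G r s T) (hg : p.GoodPool x y η G r s T)
    (hσ : p.Consistent x y [] σ) {c : Fin w} {t : ℕ} (hc : σ c = .est t) (hcs : p.level c ≤ s) :
    |(t : ℝ) / p.labels (p.level c) - η (x c)| ≤ (1 / 2 : ℝ) ^ p.level c / 4 := by
  have hcc : p.IsCenter c := hσ.center c (by simp [hc])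
  have hk := labels_pos hr.pos (p.level c)
  set k := p.labels (p.level c) with hkdef
  set N := p.nearest x (x c) k with hN
  have hks : k ≤ p.labels s := Nat.mul_le_mul_right _ (Nat.pow_le_pow_right (by norm_num) hcs)
  have hdense := hks.trans (hg.dense c hcc)
  have hcard : N.card = k := by
    rw [hN, card_nearest]
    exact min_eq_left (hdense.trans (Finset.card_le_card (Finset.filter_subset _ _)))
  have hbias : |∑ i ∈ N, η (x i) - k * η (x c)| ≤ k * ((1 / 2 : ℝ) ^ p.level c / 8) := by
    rw [← hcard, ← nsmul_eq_mul, ← nsmul_eq_mul, ← Finset.sum_const, ← Finset.sum_sub_distrib]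
    refine (Finset.abs_sum_le_sum_abs _ _).trans (Finset.sum_le_card_nsmul _ _ _ fun i hi => ?_)
    have h1 := hr.smooth s hr.one_le le_rfl _ (hg.mem c) _ (hg.mem i)
      (p.dist_le_of_mem_nearest hdense hi)
    rw [abs_sub_comm]
    refine h1.trans ?_
    have := pow_le_pow_of_le_one (by norm_num : (0 : ℝ) ≤ 1 / 2) (by norm_num) hcs
    linarith
  have hnoise := hg.noise c hcc
  rw [← hσ.est c t hc, ← hkdef, ← hN] at hnoise
  have h3 : |(t : ℝ) - k * η (x c)| ≤ k * ((1 / 2 : ℝ) ^ p.level c / 4) := by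
    rw [abs_le] at *
    constructor <;> linarith [hbias.1, hbias.2, hnoise.1, hnoise.2]
  have h4 : (t : ℝ) / k - η (x c) = (t - k * η (x c)) / k := by field_simp
  rw [h4, abs_div, abs_of_pos hk, div_le_iff₀ hk]
  linarith

/-- Among the points in use of a level `j ≤ s` whose net points are all in use, the point nearest
to `z` is within the radius `r j z`. -/
theorem exists_nearest (hn : ∀ i, p.level i = j → p.pos i < T j → σ i ≠ .out)
    {z : Inst d} (hz : p.Near x r T j z) :
    ∃ i, p.level i = j ∧ σ i ≠ .out ∧ dist z (x i) ≤ r j z ∧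
      ∀ i', p.level i' = j → σ i' ≠ .out → dist z (x i) ≤ dist z (x i') := by
  obtain ⟨i₀, h1, h2, h3⟩ := hz
  obtain ⟨i, hi, hmin⟩ := (Finset.univ.filter fun i => p.level i = j ∧ σ i ≠ .out).exists_min_image
    (fun i => dist z (x i)) ⟨i₀, by simp [h1, hn i₀ h1 h2]⟩
  simp only [Finset.mem_filter, Finset.mem_univ, true_and] at hi hmin
  exact ⟨i, hi.1, hi.2, (hmin i₀ ⟨h1, hn i₀ h1 h2⟩).trans h3, fun i' a b => hmin i' ⟨a, b⟩⟩

/-- A covered point has a large margin, if the levels `j ≤ s` below it have the asserted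
properties. -/
theorem le_margin_of_covered (hr : p.Regular η G r s T) (hg : p.GoodPool x y η G r s T)
    {c : Fin w} (hcc : p.IsCenter c) (hcs : p.level c ≤ s)
    (hn : ∀ i, 1 ≤ p.level i → p.level i < p.level c → p.pos i < T (p.level i) → σ i ≠ .out)
    (hm : ∀ i, 1 ≤ p.level i → p.level i < p.level c → p.Resolved (p.level i) (σ i) →
      2.75 * (1 / 2 : ℝ) ^ p.level i ≤ |η (x i) - 1 / 2|)
    (hcen : ∀ i, σ i ≠ .out → p.IsCenter i) (hcov : p.Covered x σ c) :
    5.25 * (1 / 2 : ℝ) ^ p.level c ≤ |η (x c) - 1 / 2| := by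
  obtain ⟨i, hic, hres, hnear⟩ := hcov
  have hi : p.IsCenter i := hcen i (by rcases hres with h | ⟨t, h, _⟩ <;> simp [h])
  obtain ⟨i₀, h1, h2, h3⟩ := hg.cover c hcc (p.level i) hi.1 (hic.le.trans hcs) hic
  have hd : dist (x c) (x i) ≤ r (p.level i) (x c) :=
    (hnear i₀ h1 (hn i₀ (h1 ▸ hi.1) (h1 ▸ hic) (h1 ▸ h2))).trans h3
  have hsm := hr.smooth (p.level i) hi.1 (hic.le.trans hcs) _ (hg.mem c) _ (hg.mem i) hd
  have hmi := hm i hi.1 hic hres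
  have h2m : 2 * (1 / 2 : ℝ) ^ p.level c ≤ (1 / 2 : ℝ) ^ p.level i := by
    have := pow_le_pow_of_le_one (by norm_num : (0 : ℝ) ≤ 1 / 2) (by norm_num)
      (Nat.succ_le_of_lt hic)
    rw [Nat.succ_eq_add_one, pow_succ] at this
    linarith
  have htri : |η (x i) - 1 / 2| ≤ |η (x c) - η (x i)| + |η (x c) - 1 / 2| := by
    have := abs_sub_le (η (x i)) (η (x c)) (1 / 2)
    rwa [abs_sub_comm (η (x i)) (η (x c))] at this
  linarith

/-- The point at a level above `j` that is not covered has a small margin, if the net of level `j`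
is in use and its points have accurate estimates. -/
theorem margin_lt_of_not_covered (hr : p.Regular η G r s T) (hg : p.GoodPool x y η G r s T)
    (hσ : p.Consistent x y [] σ) {c : Fin w} (hcc : p.IsCenter c) {j : ℕ} (hj : 1 ≤ j)
    (hjs : j ≤ s) (hjc : j < p.level c)
    (hn : ∀ i, p.level i = j → p.pos i < T j → σ i ≠ .out) (hcov : ¬ p.Covered x σ c) :
    |η (x c) - 1 / 2| < 3.375 * (1 / 2 : ℝ) ^ j := by
  obtain ⟨i, hij, hio, hd, hmin⟩ := exists_nearest hn (hg.cover c hcc j hj hjs hjc)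
  have hnr : ¬ p.Resolved (p.level i) (σ i) := fun h =>
    hcov ⟨i, hij ▸ hjc, h, fun i' hi' ho => hmin i' (hi'.trans hij) ho⟩
  rcases hsi : σ i with _ | _ | t
  · exact absurd hsi hio
  · exact absurd (Or.inl hsi) hnr
  · have h1 : p.margin (p.level i) t < 3 * (1 / 2 : ℝ) ^ p.level i := by
      by_contra! hle
      exact hnr (Or.inr ⟨t, hsi, hle⟩)
    have h2 := abs_est_sub_le hr hg hσ hsi (hij ▸ hjs)
    have hsm := hr.smooth j hj hjs _ (hg.mem c) _ (hg.mem i) hd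
    rw [margin, hij] at h1
    rw [hij] at h2
    rw [abs_lt] at *
    rw [abs_le] at *
    constructor <;> linarith [h1.1, h1.2, h2.1, h2.2, hsm.1, hsm.2]

/-- At the levels `j ≤ s`, the budget suffices for the net of level `j`, and resolved points have
a large margin. -/
theorem net_in_use (hr : p.Regular η G r s T) (hg : p.GoodPool x y η G r s T)
    (hσ : p.Consistent x y [] σ) (j : ℕ) (hj : 1 ≤ j) (hjs : j ≤ s) :
    (∀ i, p.level i = j → p.pos i < T j → σ i ≠ .out) ∧
    (∀ i, p.level i = j → p.Resolved (p.level i) (σ i) →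
      2.75 * (1 / 2 : ℝ) ^ p.level i ≤ |η (x i) - 1 / 2|) := by
  induction j using Nat.strong_induction_on with
  | _ j ih =>
  have hcen : ∀ i, p.level i = j → p.pos i < T j → p.IsCenter i := fun i h1 h2 =>
    ⟨h1 ▸ hj, h1 ▸ hjs.trans hr.le_J, h2.trans_le (hr.le_M j hj hjs)⟩
  constructor
  · intro i hij hi hout
    have hsmall : ∀ c, p.level c = j → p.pos c < T j → σ c ≠ .skipped →
        |η (x c) - 1 / 2| < 7 * (1 / 2 : ℝ) ^ j := by
      intro c hcj hcT hns
      have hcc := hcen c hcj hcT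
      have hcov : ¬ p.Covered x σ c := fun h => hns (hσ.skipped c (by simp) hcc h)
      have hpos : (0 : ℝ) < (1 / 2) ^ j := by positivity
      rcases Nat.lt_or_ge 1 j with h1j | h1j
      · have := margin_lt_of_not_covered hr hg hσ hcc (j := j - 1) (by omega) (by omega)
          (by omega) (ih (j - 1) (by omega) (by omega) (by omega)).1 hcov
        have he : (1 / 2 : ℝ) ^ (j - 1) = 2 * (1 / 2) ^ j := by
          obtain ⟨a, rfl⟩ := Nat.exists_eq_add_of_le hj
          rw [Nat.add_sub_cancel_left, pow_add]; ring
        rw [he] at this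
        linarith
      · obtain rfl : j = 1 := by omega
        have := hr.mem_Icc (x c)
        rw [abs_lt]
        constructor <;> linarith [this.1, this.2]
    -- The points queried before `i` and `i` itself would be too many points of small margin.
    have hb := hσ.budget i (by simp) (hcen i hij hi) hout
    have hf := hg.few j hj hjs
    rw [hij] at hb
    have hsub : insert i ((p.queried σ j).filter fun c' => c' < i) ⊆
        Finset.univ.filter fun i => (p.level i = j ∧ p.pos i < T j) ∧
          |η (x i) - 1 / 2| < 7 * (1 / 2 : ℝ) ^ j := by
      intro c hc
      rcases Finset.mem_insert.1 hc with rfl | hc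
      · simp only [Finset.mem_filter, Finset.mem_univ, true_and]
        exact ⟨⟨hij, hi⟩, hsmall c hij hi (by simp [hout])⟩
      · obtain ⟨hcq, hci⟩ := Finset.mem_filter.1 hc
        obtain ⟨hcj, t, ht⟩ := (Finset.mem_filter.1 hcq).2
        have hcT : p.pos c < T j := by
          refine lt_of_le_of_lt ?_ hi
          have e1 := Nat.div_add_mod (c : ℕ) p.size
          have e2 := Nat.div_add_mod (i : ℕ) p.size
          have e3 : (c : ℕ) / p.size = (i : ℕ) / p.size := hcj.trans hij.symm
          have e4 : (c : ℕ) < i := hci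
          change (c : ℕ) % p.size ≤ (i : ℕ) % p.size
          rw [e3] at e1
          omega
        simp only [Finset.mem_filter, Finset.mem_univ, true_and]
        exact ⟨⟨hcj, hcT⟩, hsmall c hcj hcT (by simp [ht])⟩
    have := Finset.card_le_card hsub
    rw [Finset.card_insert_of_notMem (by simp)] at this
    omega
  · intro i hij hres
    have hpos : (0 : ℝ) < (1 / 2) ^ p.level i := by positivity
    have hi : p.IsCenter i := hσ.center i (by rcases hres with h | ⟨t, h, _⟩ <;> simp [h])
    rcases hres with h | ⟨t, h, ht⟩
    · have := le_margin_of_covered hr hg hi (hij ▸ hjs)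
        (fun a h1 h2 h3 => (ih _ (hij ▸ h2) h1 (by omega)).1 a rfl h3)
        (fun a h1 h2 h3 => (ih _ (hij ▸ h2) h1 (by omega)).2 a rfl h3) hσ.center
        (hσ.covered i h)
      linarith
    · have h2 := abs_est_sub_le hr hg hσ h (hij ▸ hjs)
      have h3 : p.margin (p.level i) t ≤
          |(t : ℝ) / p.labels (p.level i) - η (x i)| + |η (x i) - 1 / 2| := abs_sub_le _ _ _
      linarith

/-- On a good pool, the learner classifies a point `z` of margin at least `4 * 2 ^ (-s)` correctly,
if the nets of the levels `j ≤ s` have points near `z`. -/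
theorem oneNN_eq (hr : p.Regular η G r s T) (hg : p.GoodPool x y η G r s T) {z : Inst d}
    (hz : z ∈ G) (hnear : ∀ j, 1 ≤ j → j ≤ s → p.Near x r T j z)
    (hmz : 4 * (1 / 2 : ℝ) ^ s ≤ |η z - 1 / 2|) :
    oneNN x (((p.learner d) x).activeSet y) z = bayesClassifier η z := by
  set σ := p.final x y (List.finRange w) (fun _ => .out) with hσdef
  have hσ : p.Consistent x y [] σ := p.consistent_finRange x y
  have hS : ((p.learner d) x).activeSet y = p.outputSet σ := p.activeSet_run x y _ _
  rw [hS]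
  have hη := hr.mem_Icc z
  have hhalf : |η z - 1 / 2| ≤ 1 / 2 := by
    rw [abs_le]; constructor <;> linarith [hη.1, hη.2]
  -- the level of `z`: its margin is between `2 * 2 ^ (-j)` and `4 * 2 ^ (-j)`
  obtain ⟨j, hj1, hjs, hlo, hup⟩ : ∃ j, 1 ≤ j ∧ j + 1 ≤ s ∧
      2 * (1 / 2 : ℝ) ^ j ≤ |η z - 1 / 2| ∧ |η z - 1 / 2| < 4 * (1 / 2 : ℝ) ^ j := by
    have hex : ∃ j, 2 * (1 / 2 : ℝ) ^ j ≤ |η z - 1 / 2| :=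
      ⟨s, by linarith [show (0 : ℝ) < (1 / 2) ^ s by positivity]⟩
    have hspec := Nat.find_spec hex
    have h2 : 2 ≤ Nat.find hex := by
      by_contra! hlt
      have := pow_le_pow_of_le_one (by norm_num : (0 : ℝ) ≤ 1 / 2) (by norm_num)
        (show Nat.find hex ≤ 1 by omega)
      linarith
    refine ⟨Nat.find hex, by omega, ?_, hspec, ?_⟩
    · have hs1 := hr.one_le
      have : Nat.find hex ≤ s - 1 := Nat.find_min' hex (by
        have he : (1 / 2 : ℝ) ^ (s - 1) = 2 * (1 / 2) ^ s := by
          obtain ⟨a, rfl⟩ := Nat.exists_eq_add_of_le hs1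
          rw [Nat.add_sub_cancel_left, pow_add]; ring
        rw [he]; linarith)
      omega
    · have := not_le.1 (Nat.find_min hex (show Nat.find hex - 1 < Nat.find hex by omega))
      have he : (1 / 2 : ℝ) ^ (Nat.find hex - 1) = 2 * (1 / 2) ^ Nat.find hex := by
        obtain ⟨a, ha⟩ := Nat.exists_eq_add_of_le (show 1 ≤ Nat.find hex by omega)
        rw [ha, Nat.add_sub_cancel_left, pow_add]; ring
      rw [he] at this
      linarith
  have hjs' : j ≤ s := by omega
  have hpos : (0 : ℝ) < (1 / 2) ^ j := by positivity
  obtain ⟨i, hij, hiT, hid⟩ := hnear j hj1 hjs'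
  have hiout := (net_in_use hr hg hσ j hj1 hjs').1 i hij hiT
  have hic := hσ.center i hiout
  have hsm := hr.smooth j hj1 hjs' _ hz _ (hg.mem i) hid
  have hmi : |η (x i) - 1 / 2| < 4.125 * (1 / 2 : ℝ) ^ j := by
    have := abs_sub_le (η (x i)) (η z) (1 / 2)
    rw [abs_sub_comm (η (x i)) (η z)] at this
    linarith
  have hmi' : 1.875 * (1 / 2 : ℝ) ^ j ≤ |η (x i) - 1 / 2| := by
    have := abs_sub_le (η z) (η (x i)) (1 / 2)
    linarith
  -- the net point near `z` is labelled
  have hlab : p.outputSet σ i ≠ none := by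
    rcases hsi : σ i with _ | _ | t
    · exact absurd hsi hiout
    · have := le_margin_of_covered hr hg hic (hij ▸ hjs')
        (fun a h1 h2 h3 => (net_in_use hr hg hσ _ h1 (by omega)).1 a rfl h3)
        (fun a h1 h2 h3 => (net_in_use hr hg hσ _ h1 (by omega)).2 a rfl h3) hσ.center
        (hσ.covered i hsi)
      rw [hij] at this
      linarith
    · have h2 := abs_est_sub_le hr hg hσ hsi (hij ▸ hjs')
      have h3 : |η (x i) - 1 / 2| ≤
          |(t : ℝ) / p.labels (p.level i) - η (x i)| + p.margin (p.level i) t := by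
        have := abs_sub_le (η (x i)) ((t : ℝ) / p.labels (p.level i)) (1 / 2)
        rwa [abs_sub_comm (η (x i)) ((t : ℝ) / p.labels (p.level i))] at this
      have h4 : (1 / 2 : ℝ) ^ p.level i ≤ p.margin (p.level i) t := by
        rw [hij] at h2 h3 ⊢
        linarith
      simp only [outputSet, hsi]
      rw [if_pos h4]
      simp
  -- every labelled point nearest to `z` carries the right label
  have hright : ∀ a, IsNearest x (p.outputSet σ) z a →
      p.outputSet σ a = some (bayesClassifier η z) := by
    intro a ha
    have had : dist z (x a) ≤ r j z := (ha.2 i hlab).trans hid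
    have hsma := hr.smooth j hj1 hjs' _ hz _ (hg.mem a) had
    have hma : 1.875 * (1 / 2 : ℝ) ^ j ≤ |η (x a) - 1 / 2| := by
      have := abs_sub_le (η z) (η (x a)) (1 / 2)
      linarith
    have hlab' := ha.1
    rcases hsa : σ a with _ | _ | t
    · simp [outputSet, hsa] at hlab'
    · simp [outputSet, hsa] at hlab'
    · have hac := hσ.center a (by simp [hsa])
      have hmarg : (1 / 2 : ℝ) ^ p.level a ≤ p.margin (p.level a) t := by
        by_contra hlt
        simp [outputSet, hsa] at hlab'
        exact hlt (by simpa using hlab')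
      have hcov : ¬ p.Covered x σ a := fun h => by
        simp [hσ.skipped a (by simp) hac h] at hsa
      have has : p.level a ≤ s := by
        by_contra! hlt
        have h1 := margin_lt_of_not_covered hr hg hσ hac hr.one_le le_rfl hlt
          (net_in_use hr hg hσ s hr.one_le le_rfl).1 hcov
        have h2 := pow_le_pow_of_le_one (by norm_num : (0 : ℝ) ≤ 1 / 2) (by norm_num) hjs
        rw [pow_succ] at h2
        linarith
      have hest := abs_est_sub_le hr hg hσ hsa has
      have hval : p.outputSet σ a = some (decide (1 / 2 ≤ (t : ℝ) / p.labels (p.level a))) := by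
        simp only [outputSet, hsa]
        rw [if_pos hmarg]
      rw [hval]
      congr 1
      unfold bayesClassifier
      rw [decide_eq_decide]
      have hposa : (0 : ℝ) < (1 / 2) ^ p.level a := by positivity
      unfold margin at hmarg
      rw [abs_le] at hest hsma
      rw [le_abs] at hmarg hlo
      constructor
      · intro h
        by_contra! hlt
        rcases hmarg with hm | hm <;> rcases hlo with hl | hl <;>
          linarith [hest.1, hest.2, hsma.1, hsma.2, le_abs_self (η (x a) - 1 / 2),
            neg_abs_le (η (x a) - 1 / 2)]
      · intro h
        by_contra! hlt
        rcases hmarg with hm | hm <;> rcases hlo with hl | hl <;>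
          linarith [hest.1, hest.2, hsma.1, hsma.2]
  -- the nearest labelled point of smallest index
  obtain ⟨a₀, ha₀, hmin⟩ := (Finset.univ.filter fun a => p.outputSet σ a ≠ none).exists_min_image
    (fun a => dist z (x a)) ⟨i, by simp [hlab]⟩
  have hex : (Finset.univ.filter fun a => IsNearest x (p.outputSet σ) z a).Nonempty :=
    ⟨a₀, by
      simp only [Finset.mem_filter, Finset.mem_univ, true_and] at ha₀ hmin ⊢
      exact ⟨ha₀, hmin⟩⟩
  have hmem := Finset.min'_mem _ hex
  have hmem' : IsNearest x (p.outputSet σ) z (Finset.min' _ hex) := by simpa using hmem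
  have hfirst : ∀ b < Finset.min' _ hex, ¬ IsNearest x (p.outputSet σ) z b := fun b hb hbn =>
    absurd (Finset.min'_le _ b (by simpa using hbn)) (not_le.2 hb)
  unfold oneNN
  rcases hb : bayesClassifier η z with _ | _
  · rw [decide_eq_false_iff_not]
    rintro ⟨a, ha, -, hat⟩
    rw [hright a ha, hb] at hat
    simp at hat
  · rw [decide_eq_true_iff]
    exact ⟨_, hmem', hfirst, hb ▸ hright _ hmem'⟩

end

end Schedule

end Correctness

/-! ### Independent samples -/

section Sampling

open ProbabilityTheory
open scoped Classical ENNReal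

variable {ι E : Type*} [Fintype ι] [MeasurableSpace E]

/-- A sample avoids a set of probability at least `q` with exponentially small probability. -/
theorem pi_forall_notMem_le (μ : Measure E) [IsProbabilityMeasure μ] {A : Set E}
    (hA : MeasurableSet A) {q : ℝ} (hq : q ≤ μ.real A) (I : Finset ι) :
    Measure.pi (fun _ : ι => μ) {x | ∀ i ∈ I, x i ∉ A} ≤
      ENNReal.ofReal (Real.exp (-(q * I.card))) := by
  have h : {x : ι → E | ∀ i ∈ I, x i ∉ A} = (I : Set ι).pi fun _ => Aᶜ := by
    ext x; simp [Set.mem_pi]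
  rw [h, Measure.pi_pi_finset, Finset.prod_const, ← ofReal_measureReal,
    ← ENNReal.ofReal_pow measureReal_nonneg]
  apply ENNReal.ofReal_le_ofReal
  rw [show -(q * (I.card : ℝ)) = I.card * (-q) by ring, Real.exp_nat_mul]
  refine pow_le_pow_left₀ measureReal_nonneg ?_ _
  rw [probReal_compl_eq_one_sub hA]
  linarith [Real.add_one_le_exp (-q)]

/-- The Chernoff bound for the number of sample points in a set. -/
theorem pi_le_mul_card_le (μ : Measure E) [IsProbabilityMeasure μ] {A : Set E}
    (hA : MeasurableSet A) (θ a : ℝ) (I : Finset ι) :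
    (Measure.pi fun _ : ι => μ).real {x | a ≤ θ * (I.filter fun i => x i ∈ A).card} ≤
      Real.exp ((Real.exp θ - 1) * μ.real A * I.card - a) := by
  set X : ι → (ι → E) → ℝ := fun i x => A.indicator (fun _ => θ) (x i) with hX
  have hmA : Measurable (A.indicator fun _ : E => θ) := measurable_const.indicator hA
  have hm : ∀ i, Measurable (X i) := fun i => hmA.comp (measurable_pi_apply i)
  have hind : iIndepFun X (Measure.pi fun _ : ι => μ) :=
    iIndepFun_pi (X := fun _ : ι => A.indicator fun _ : E => θ) fun _ => hmA.aemeasurable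
  have hsum : ∀ x, (∑ i ∈ I, X i) x = θ * (I.filter fun i => x i ∈ A).card := by
    intro x
    rw [Finset.sum_apply]
    simp only [hX, Set.indicator_apply]
    rw [← Finset.sum_filter, Finset.sum_const, nsmul_eq_mul, mul_comm]
  have hset : {x : ι → E | a ≤ θ * (I.filter fun i => x i ∈ A).card} =
      {x | a ≤ (∑ i ∈ I, X i) x} := by ext x; simp only [Set.mem_ofPred_eq, hsum]
  have hmgf : ∀ i, mgf (X i) (Measure.pi fun _ : ι => μ) 1 ≤
      Real.exp ((Real.exp θ - 1) * μ.real A) := by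
    intro i
    have h1 : mgf (X i) (Measure.pi fun _ : ι => μ) 1 =
        ∫ z, Real.exp (A.indicator (fun _ => θ) z) ∂μ := by
      simp only [mgf, hX, one_mul]
      exact integral_comp_eval (μ := fun _ : ι => μ) (i := i)
        (f := fun z => Real.exp (A.indicator (fun _ => θ) z))
        (Real.measurable_exp.comp hmA).aestronglyMeasurable
    have h2 : ∀ z, Real.exp (A.indicator (fun _ => θ) z) =
        1 + A.indicator (fun _ => Real.exp θ - 1) z := by
      intro z; by_cases hz : z ∈ A <;> simp [hz]
    rw [h1]
    simp_rw [h2]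
    rw [integral_add (integrable_const _) ((integrable_const _).indicator hA),
      integral_indicator_const _ hA]
    simp only [integral_const, probReal_univ, smul_eq_mul]
    linarith [Real.add_one_le_exp ((Real.exp θ - 1) * μ.real A)]
  have hint : Integrable (fun x => Real.exp (1 * (∑ i ∈ I, X i) x))
      (Measure.pi fun _ : ι => μ) := by
    refine Integrable.of_bound (C := Real.exp (|θ| * I.card)) ?_ (Filter.Eventually.of_forall ?_)
    · have : Measurable (∑ i ∈ I, X i) := by
        rw [show (∑ i ∈ I, X i) = fun x => ∑ i ∈ I, X i x by ext x; simp]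
        exact Finset.measurable_sum _ fun i _ => hm i
      exact (Real.measurable_exp.comp (measurable_const.mul this)).aestronglyMeasurable
    · intro x
      rw [Real.norm_eq_abs, Real.abs_exp, one_mul, hsum]
      apply Real.exp_le_exp.2
      refine (mul_le_mul_of_nonneg_right (le_abs_self θ) (Nat.cast_nonneg _)).trans ?_
      gcongr
      exact Finset.filter_subset _ _
  rw [hset]
  refine (measure_ge_le_exp_mul_mgf a zero_le_one hint).trans ?_
  rw [hind.mgf_sum hm, sub_eq_neg_add, Real.exp_add]
  refine mul_le_mul (by simp) ?_ (Finset.prod_nonneg fun i _ => mgf_nonneg) (Real.exp_nonneg _)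
  refine (Finset.prod_le_prod (fun i _ => mgf_nonneg) fun i _ => hmgf i).trans ?_
  rw [Finset.prod_const, ← Real.exp_nat_mul]
  apply le_of_eq
  ring_nf

/-- It is unlikely that fewer than `k` sample points fall in a set of probability at least `q`. -/
theorem pi_card_lt_le (μ : Measure E) [IsProbabilityMeasure μ] {A : Set E}
    (hA : MeasurableSet A) {q : ℝ} (hq : q ≤ μ.real A) (I : Finset ι) (k : ℕ) :
    Measure.pi (fun _ : ι => μ) {x | (I.filter fun i => x i ∈ A).card < k} ≤
      ENNReal.ofReal (Real.exp (k - q * I.card / 2)) := by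
  refine (measure_mono (t := {x | -(k : ℝ) ≤ -1 * (I.filter fun i => x i ∈ A).card}) ?_).trans ?_
  · intro x hx
    have : ((I.filter fun i => x i ∈ A).card : ℝ) < k := by exact_mod_cast hx
    simp only [Set.mem_ofPred_eq]
    linarith
  · rw [← ofReal_measureReal]
    apply ENNReal.ofReal_le_ofReal
    refine (pi_le_mul_card_le μ hA (-1) (-k) I).trans (Real.exp_le_exp.2 ?_)
    have h1 : Real.exp (-1) ≤ 1 / 2 := by
      rw [Real.exp_neg, inv_eq_one_div]
      exact one_div_le_one_div_of_le (by norm_num) (by linarith [Real.add_one_le_exp (1 : ℝ)])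
    have h2 : (Real.exp (-1) - 1) * μ.real A ≤ -(q / 2) := by
      nlinarith [measureReal_nonneg (μ := μ) (s := A)]
    have h3 : (0 : ℝ) ≤ I.card := Nat.cast_nonneg _
    nlinarith

/-- It is unlikely that the number of sample points in a set of probability at most `b` exceeds
twice its mean by much. -/
theorem pi_lt_card_le (μ : Measure E) [IsProbabilityMeasure μ] {A : Set E}
    (hA : MeasurableSet A) {b : ℝ} (hb : μ.real A ≤ b) (I : Finset ι) (a : ℝ) :
    Measure.pi (fun _ : ι => μ) {x | 2 * b * I.card + a < (I.filter fun i => x i ∈ A).card} ≤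
      ENNReal.ofReal (Real.exp (-a)) := by
  refine (measure_mono
    (t := {x | 2 * b * I.card + a ≤ 1 * (I.filter fun i => x i ∈ A).card}) ?_).trans ?_
  · intro x hx
    simp only [Set.mem_ofPred_eq, one_mul] at hx ⊢
    exact hx.le
  · rw [← ofReal_measureReal]
    apply ENNReal.ofReal_le_ofReal
    refine (pi_le_mul_card_le μ hA 1 _ I).trans (Real.exp_le_exp.2 ?_)
    have h1 : Real.exp 1 - 1 ≤ 2 := by linarith [Real.exp_one_lt_d9]
    have h2 : (Real.exp 1 - 1) * μ.real A ≤ 2 * b := by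
      nlinarith [measureReal_nonneg (μ := μ) (s := A)]
    have h3 : (0 : ℝ) ≤ I.card := Nat.cast_nonneg _
    nlinarith

/-- Resampling one coordinate preserves the law of a sample. -/
theorem measurePreserving_update [DecidableEq ι] (μ : Measure E) [IsProbabilityMeasure μ] (c : ι) :
    MeasurePreserving (fun p : (ι → E) × E => Function.update p.1 c p.2)
      ((Measure.pi fun _ : ι => μ).prod μ) (Measure.pi fun _ : ι => μ) := by
  have hm : Measurable fun p : (ι → E) × E => Function.update p.1 c p.2 := by
    refine measurable_pi_iff.2 fun i => ?_
    by_cases h : i = c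
    · subst h; simpa using measurable_snd
    · simp only [Function.update_of_ne h]
      exact (measurable_pi_apply i).comp measurable_fst
  refine ⟨hm, (Measure.pi_eq fun s hs => ?_).symm⟩
  rw [Measure.map_apply hm (MeasurableSet.univ_pi hs)]
  have h : (fun p : (ι → E) × E => Function.update p.1 c p.2) ⁻¹' Set.univ.pi s =
      ((Finset.univ.erase c : Finset ι) : Set ι).pi s ×ˢ s c := by
    ext p
    simp only [Set.mem_preimage, Set.mem_pi, Set.mem_univ, true_imp_iff, Set.mem_prod,
      Finset.coe_erase, Finset.coe_univ, Set.mem_sdiff, Set.mem_singleton_iff, true_and]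
    constructor
    · intro h
      exact ⟨fun i hi => by simpa [Function.update_of_ne hi] using h i, by simpa using h c⟩
    · rintro ⟨h1, h2⟩ i
      by_cases hi : i = c
      · subst hi; simpa using h2
      · simpa [Function.update_of_ne hi] using h1 i hi
  rw [h, Measure.prod_prod, Measure.pi_pi_finset, mul_comm]
  exact Finset.mul_prod_erase _ (fun i => μ (s i)) (Finset.mem_univ c)

/-- If an event does not depend on the coordinate `c` of the sample but on a further point `z`,
then a bound on its probability that is uniform in `z` remains true when `z` is the sample point
with index `c`. -/
theorem pi_mem_self_le [DecidableEq ι] (μ : Measure E) [IsProbabilityMeasure μ] (c : ι)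
    {S : Set ((ι → E) × E)} (hS : MeasurableSet S)
    (hdep : ∀ x z z', (Function.update x c z', z) ∈ S ↔ (x, z) ∈ S) {b : ℝ≥0∞}
    (hb : ∀ z, Measure.pi (fun _ : ι => μ) {x | (x, z) ∈ S} ≤ b) :
    Measure.pi (fun _ : ι => μ) {x | (x, x c) ∈ S} ≤ b := by
  have hm : Measurable fun x : ι → E => (x, x c) := measurable_id.prodMk (measurable_pi_apply c)
  have hSm : MeasurableSet {x : ι → E | (x, x c) ∈ S} := hm hS
  rw [← (measurePreserving_update μ c).measure_preimage hSm.nullMeasurableSet]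
  have : (fun p : (ι → E) × E => Function.update p.1 c p.2) ⁻¹' {x | (x, x c) ∈ S} = S := by
    ext ⟨x, z⟩
    simp [hdep]
  rw [this, Measure.prod_apply_symm hS]
  refine (lintegral_mono (g := fun _ => b) fun z => hb z).trans ?_
  simp

end Sampling

/-! ### Labels -/

section Labels

open ProbabilityTheory
open scoped Classical ENNReal

/-- The uniform distribution on the unit interval. -/
noncomputable def unif : Measure ℝ := volume.restrict (Set.Icc 0 1)

instance : IsProbabilityMeasure unif := ⟨by simp [unif]⟩

theorem unif_Iio {a : ℝ} (h1 : a ≤ 1) : unif (Set.Iio a) = ENNReal.ofReal a := by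
  rw [unif, Measure.restrict_apply measurableSet_Iio]
  have : Set.Iio a ∩ Set.Icc 0 1 = Set.Ico 0 a := by
    ext u
    simp only [Set.mem_inter_iff, Set.mem_Iio, Set.mem_Icc, Set.mem_Ico]
    constructor
    · rintro ⟨h, h', -⟩; exact ⟨h', h⟩
    · rintro ⟨h, h'⟩; exact ⟨h', h, by linarith⟩
  rw [this, Real.volume_Ico, sub_zero]

/-- **Hoeffding's inequality** for independent Bernoulli variables with means `a i`, realised by
uniform variables. -/
theorem pi_unif_hoeffding {ι : Type*} [Fintype ι] {a : ι → ℝ} (ha : ∀ i, a i ∈ Set.Icc (0 : ℝ) 1)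
    (S : Finset ι) {k : ℕ} (hS : S.card ≤ k) {θ : ℝ} (hθ : 0 ≤ θ) :
    Measure.pi (fun _ : ι => unif)
      {u | k * θ < |((S.filter fun i => u i < a i).card : ℝ) - ∑ i ∈ S, a i|} ≤
      ENNReal.ofReal (2 * Real.exp (-(2 * k * θ ^ 2))) := by
  set ν := Measure.pi fun _ : ι => unif with hν
  set g : ι → ℝ → ℝ := fun i u => (Set.Iio (a i)).indicator (fun _ => 1) u with hg
  have hgm : ∀ i, Measurable (g i) := fun i => measurable_const.indicator measurableSet_Iio
  have hgI : ∀ i u, g i u ∈ Set.Icc (0 : ℝ) 1 := by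
    intro i u
    by_cases h : u < a i <;> simp [hg, h]
  have hint : ∀ i, ∫ u, g i u ∂unif = a i := by
    intro i
    simp only [hg]
    rw [integral_indicator_const _ measurableSet_Iio, measureReal_def,
      unif_Iio (ha i).2, ENNReal.toReal_ofReal (ha i).1]
    simp
  set X : ι → (ι → ℝ) → ℝ := fun i u => g i (u i) - a i with hX
  have hsub0 : ∀ i, HasSubgaussianMGF (X i) ((‖(1 : ℝ) - 0‖₊ / 2) ^ 2) ν := by
    intro i
    have h1 : HasSubgaussianMGF (fun u : ι → ℝ => g i (u i) - ∫ u : ι → ℝ, g i (u i) ∂ν)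
        ((‖(1 : ℝ) - 0‖₊ / 2) ^ 2) ν :=
      hasSubgaussianMGF_of_mem_Icc ((hgm i).comp (measurable_pi_apply i)).aemeasurable
        (Filter.Eventually.of_forall fun u => hgI i (u i))
    have h2 : ∫ u : ι → ℝ, g i (u i) ∂ν = a i := by
      rw [← hint i]
      exact integral_comp_eval (μ := fun _ : ι => unif) (i := i) (hgm i).aestronglyMeasurable
    rw [h2] at h1
    exact h1
  have hind : iIndepFun X ν :=
    iIndepFun_pi (X := fun i u => g i u - a i) fun i => ((hgm i).sub_const _).aemeasurable
  have hind' : iIndepFun (fun i => -X i) ν :=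
    iIndepFun_pi (X := fun i u => -(g i u - a i)) fun i => ((hgm i).sub_const _).neg.aemeasurable
  have hsum : ∀ u, ∑ i ∈ S, X i u = ((S.filter fun i => u i < a i).card : ℝ) - ∑ i ∈ S, a i := by
    intro u
    simp only [hX, hg, Finset.sum_sub_distrib, Set.indicator_apply, Set.mem_Iio]
    congr 1
    rw [← Finset.sum_filter]; simp
  have hk : (0 : ℝ) ≤ k * θ := by positivity
  have hc : ((∑ i ∈ S, (‖(1 : ℝ) - 0‖₊ / 2) ^ 2 : NNReal) : ℝ) = S.card / 4 := by
    simp; ring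
  by_cases hS0 : S.card = 0
  · have : S = ∅ := Finset.card_eq_zero.1 hS0
    subst this
    have h0 : {u : ι → ℝ | k * θ < |(((∅ : Finset ι).filter fun i => u i < a i).card : ℝ) -
        ∑ i ∈ (∅ : Finset ι), a i|} = ∅ := by
      ext u; simp [hk]
    rw [h0]; simp
  have hbound : Real.exp (-(k * θ) ^ 2 / (2 * (S.card / 4))) ≤
      Real.exp (-(2 * k * θ ^ 2)) := by
    apply Real.exp_le_exp.2
    have hSpos : (0 : ℝ) < S.card := by exact_mod_cast Nat.pos_of_ne_zero hS0
    have hSk : (S.card : ℝ) ≤ k := by exact_mod_cast hS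
    rw [div_le_iff₀ (by positivity)]
    nlinarith [mul_le_mul_of_nonneg_left hSk (by positivity : (0 : ℝ) ≤ k * θ ^ 2)]
  have h1 := HasSubgaussianMGF.measure_sum_ge_le_of_iIndepFun hind (s := S) (fun i _ => hsub0 i) hk
  have h2 := HasSubgaussianMGF.measure_sum_ge_le_of_iIndepFun hind' (s := S) (fun i _ => (hsub0 i).neg) hk
  rw [hc] at h1 h2
  rw [← ofReal_measureReal]
  apply ENNReal.ofReal_le_ofReal
  refine (measureReal_mono (s₂ := {u | k * θ ≤ ∑ i ∈ S, X i u} ∪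
    {u | k * θ ≤ ∑ i ∈ S, (-X i) u}) ?_).trans ?_
  · intro u hu
    simp only [Set.mem_ofPred_eq, ← hsum, lt_abs] at hu
    simp only [Set.mem_union, Set.mem_ofPred_eq, Pi.neg_apply, Finset.sum_neg_distrib]
    exact hu.imp le_of_lt le_of_lt
  · refine (measureReal_union_le _ _).trans ?_
    linarith

variable {d : ℕ} {P : Measure (Inst d × Bool)} {η : Inst d → ℝ}

/-- Draw `x` from the marginal and give it the label `u < η x` with a uniform `u`. -/
noncomputable def labelled (η : Inst d → ℝ) (p : Inst d × ℝ) : Inst d × Bool :=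
  (p.1, decide (p.2 < η p.1))

theorem measurable_labelled (hη : Measurable η) : Measurable (labelled η) := by
  refine measurable_fst.prodMk (measurable_to_bool ?_)
  have : (fun p : Inst d × ℝ => decide (p.2 < η p.1)) ⁻¹' {true} = {p | p.2 < η p.1} := by
    ext p; simp
  rw [this]
  exact measurableSet_lt measurable_snd (hη.comp measurable_fst)

theorem measurePreserving_labelled [IsProbabilityMeasure P] (h : IsRegressionFunction P η) :
    MeasurePreserving (labelled η) (P.fst.prod unif) P := by
  refine ⟨measurable_labelled h.measurable, ?_⟩
  set Q := (P.fst.prod unif).map (labelled η) with hQ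
  have hm := measurable_labelled h.measurable
  have : IsProbabilityMeasure Q := Measure.isProbabilityMeasure_map hm.aemeasurable
  have htrue : ∀ A : Set (Inst d), MeasurableSet A → Q (A ×ˢ {true}) = P (A ×ˢ {true}) := by
    intro A hA
    rw [hQ, Measure.map_apply hm (hA.prod (MeasurableSet.singleton _)), h.condProb A hA,
      Measure.prod_apply (hm (hA.prod (MeasurableSet.singleton _))), ← lintegral_indicator hA]
    refine lintegral_congr fun x => ?_
    by_cases hx : x ∈ A
    · rw [Set.indicator_of_mem hx, ← unif_Iio (h.mem_Icc x).2]
      congr 1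
      ext u; simp [labelled, hx]
    · rw [Set.indicator_of_notMem hx]
      convert measure_empty (μ := unif)
      ext u; simp [labelled, hx]
  have huniv : ∀ A : Set (Inst d), MeasurableSet A → Q (A ×ˢ Set.univ) = P (A ×ˢ Set.univ) := by
    intro A hA
    rw [hQ, Measure.map_apply hm (hA.prod MeasurableSet.univ)]
    have : labelled η ⁻¹' (A ×ˢ Set.univ) = A ×ˢ Set.univ := by
      ext p
      simpa [labelled] using fun _ => le_or_gt _ _
    rw [this, Measure.prod_prod, measure_univ, mul_one, Measure.fst_apply hA, Set.prod_univ]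
  have hfalse : ∀ R : Measure (Inst d × Bool), IsProbabilityMeasure R → ∀ A : Set (Inst d),
      MeasurableSet A → R (A ×ˢ {false}) = R (A ×ˢ Set.univ) - R (A ×ˢ {true}) := by
    intro R _ A hA
    have : A ×ˢ {false} = (A ×ˢ (Set.univ : Set Bool)) \ (A ×ˢ {true}) := by
      ext ⟨x, b⟩; cases b <;> simp
    rw [this, measure_sdiff (Set.prod_mono_right (Set.subset_univ _))
      (hA.prod (MeasurableSet.singleton _)).nullMeasurableSet (measure_ne_top _ _)]
  ext B hB
  have hdec : B = ((fun x => (x, true)) ⁻¹' B) ×ˢ {true} ∪ ((fun x => (x, false)) ⁻¹' B) ×ˢ {false} := by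
    ext ⟨x, b⟩; cases b <;> simp
  have hBt : MeasurableSet ((fun x : Inst d => (x, true)) ⁻¹' B) :=
    (measurable_id.prodMk measurable_const) hB
  have hBf : MeasurableSet ((fun x : Inst d => (x, false)) ⁻¹' B) :=
    (measurable_id.prodMk measurable_const) hB
  have hdisj : Disjoint (((fun x : Inst d => (x, true)) ⁻¹' B) ×ˢ {true})
      (((fun x : Inst d => (x, false)) ⁻¹' B) ×ˢ {false}) := by
    rw [Set.disjoint_left]; rintro ⟨x, b⟩ h1 h2
    simp at h1 h2
    rw [h1.2] at h2; simp at h2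
  rw [hdec, measure_union hdisj (hBf.prod (MeasurableSet.singleton _)),
    measure_union hdisj (hBf.prod (MeasurableSet.singleton _)), htrue _ hBt,
    hfalse Q this _ hBf, hfalse P ‹_› _ hBf, htrue _ hBf, huniv _ hBf]

/-- If the unlabelled sample determines a set of at most `k` sample points, then the number of
positive labels in it is close to its conditional mean. -/
theorem pi_label_deviation_le [IsProbabilityMeasure P] (h : IsRegressionFunction P η) {w : ℕ}
    (S : (Fin w → Inst d) → Finset (Fin w)) (hSm : ∀ i, MeasurableSet {x | i ∈ S x}) {k : ℕ}
    (hS : ∀ x, (S x).card ≤ k) {θ : ℝ} (hθ : 0 ≤ θ) :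
    Measure.pi (fun _ : Fin w => P)
      {D | k * θ < |(((S fun i => (D i).1).filter fun i => (D i).2 = true).card : ℝ) -
        ∑ i ∈ S fun i => (D i).1, η (D i).1|} ≤
      ENNReal.ofReal (2 * Real.exp (-(2 * k * θ ^ 2))) := by
  have hfst : Measurable fun D : Fin w → Inst d × Bool => fun i => (D i).1 :=
    measurable_pi_iff.2 fun i => measurable_fst.comp (measurable_pi_apply i)
  have hmeas : MeasurableSet {D : Fin w → Inst d × Bool |
      k * θ < |(((S fun i => (D i).1).filter fun i => (D i).2 = true).card : ℝ) -
        ∑ i ∈ S fun i => (D i).1, η (D i).1|} := by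
    have e : ∀ D : Fin w → Inst d × Bool,
        (((S fun i => (D i).1).filter fun i => (D i).2 = true).card : ℝ) -
          ∑ i ∈ S fun i => (D i).1, η (D i).1 =
        ∑ i, {D : Fin w → Inst d × Bool | i ∈ S fun i => (D i).1}.indicator
          (fun D => {D : Fin w → Inst d × Bool | (D i).2 = true}.indicator (fun _ => (1 : ℝ)) D
            - η (D i).1) D := by
      intro D
      rw [Finset.card_eq_sum_ones, Nat.cast_sum, Finset.sum_filter, ← Finset.sum_sub_distrib]
      simp only [Set.indicator_apply, Set.mem_ofPred_eq]
      rw [← Finset.sum_filter]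
      simp
    simp_rw [e]
    refine measurableSet_lt measurable_const (continuous_abs.measurable.comp
      (Finset.measurable_sum _ fun i _ =>
        Measurable.indicator (Measurable.sub ?_ ?_) (hfst (hSm i))))
    · refine measurable_const.indicator ?_
      exact (measurable_snd.comp (measurable_pi_apply i)) (MeasurableSet.singleton true)
    · exact h.measurable.comp (measurable_fst.comp (measurable_pi_apply i))
  have hmp1 := measurePreserving_pi (fun _ : Fin w => P.fst.prod unif) (fun _ : Fin w => P)
    fun _ => measurePreserving_labelled h
  rw [← hmp1.measure_preimage hmeas.nullMeasurableSet]
  have hmp2 := (measurePreserving_arrowProdEquivProdArrow (Inst d) ℝ (Fin w)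
    (fun _ => P.fst) (fun _ => unif)).symm
  have hmeas2 := hmp1.measurable hmeas
  rw [← hmp2.measure_preimage hmeas2.nullMeasurableSet,
    Measure.prod_apply (hmp2.measurable hmeas2)]
  refine (lintegral_mono (g := fun _ => ENNReal.ofReal (2 * Real.exp (-(2 * k * θ ^ 2))))
    fun x => ?_).trans (by simp)
  refine le_of_eq_of_le ?_
    (pi_unif_hoeffding (a := fun i => η (x i)) (fun i => h.mem_Icc (x i)) (S x) (hS x) hθ)
  congr 1
  ext u
  simp [labelled, MeasurableEquiv.arrowProdEquivProdArrow, Equiv.arrowProdEquivProdArrow]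

end Labels

/-! ### Mass radii -/

section MassRadius

open scoped ENNReal

variable {E : Type*} [PseudoMetricSpace E] [MeasurableSpace E]

/-- The smallest radius of a closed ball around `z` of measure at least `q`. -/
noncomputable def massRadius (μ : Measure E) (q : ℝ) (z : E) : ℝ :=
  sInf {r | 0 ≤ r ∧ q ≤ μ.real (Metric.closedBall z r)}

theorem massRadius_bddBelow (μ : Measure E) (q : ℝ) (z : E) :
    BddBelow {r | 0 ≤ r ∧ q ≤ μ.real (Metric.closedBall z r)} :=
  ⟨0, fun _ h => h.1⟩

theorem massRadius_nonempty (μ : Measure E) [IsProbabilityMeasure μ] {q : ℝ} (hq : q < 1) (z : E) :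
    {r | 0 ≤ r ∧ q ≤ μ.real (Metric.closedBall z r)}.Nonempty := by
  have h : Filter.Tendsto (fun n : ℕ => μ (Metric.closedBall z n)) Filter.atTop (nhds 1) := by
    have h1 := tendsto_measure_iUnion_atTop (μ := μ) (s := fun n : ℕ => Metric.closedBall z n)
      fun a b hab => Metric.closedBall_subset_closedBall (by exact_mod_cast hab)
    rwa [Metric.iUnion_closedBall_nat, measure_univ] at h1
  have h2 := (ENNReal.tendsto_toReal ENNReal.one_ne_top).comp h
  obtain ⟨n, hn⟩ := (h2.eventually (lt_mem_nhds (by simpa using hq))).exists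
  exact ⟨n, Nat.cast_nonneg n, hn.le⟩

theorem massRadius_nonneg (μ : Measure E) (q : ℝ) (z : E) : 0 ≤ massRadius μ q z :=
  Real.sInf_nonneg fun _ h => h.1

theorem measure_ball_massRadius_le (μ : Measure E) [IsProbabilityMeasure μ] {q : ℝ}
    (hq0 : 0 < q) (z : E) : μ.real (Metric.ball z (massRadius μ q z)) ≤ q := by
  set R := massRadius μ q z with hR
  have hlt : ∀ r, r < R → μ.real (Metric.closedBall z r) ≤ q := by
    intro r hr
    rcases lt_or_ge r 0 with h0 | h0
    · rw [Metric.closedBall_eq_empty.2 h0]; simpa using hq0.le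
    · have := notMem_of_lt_csInf hr (massRadius_bddBelow μ q z)
      by_contra! hle
      exact this ⟨h0, hle.le⟩
  have hunion : Metric.ball z R = ⋃ n : ℕ, Metric.closedBall z (R - 1 / ((n : ℝ) + 1)) := by
    ext a
    simp only [Metric.mem_ball, Metric.mem_closedBall, Set.mem_iUnion]
    constructor
    · intro h
      obtain ⟨n, hn⟩ := exists_nat_one_div_lt (sub_pos.2 h)
      exact ⟨n, by linarith⟩
    · rintro ⟨n, hn⟩
      have : (0 : ℝ) < 1 / ((n : ℝ) + 1) := by positivity
      linarith
  have h1 := tendsto_measure_iUnion_atTop (μ := μ)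
    (s := fun n : ℕ => Metric.closedBall z (R - 1 / ((n : ℝ) + 1)))
    (fun a b hab => Metric.closedBall_subset_closedBall (by gcongr))
  rw [← hunion] at h1
  refine le_of_tendsto' ((ENNReal.tendsto_toReal (measure_ne_top _ _)).comp h1) fun n => ?_
  exact hlt _ (by linarith [show (0 : ℝ) < 1 / ((n : ℝ) + 1) by positivity])

variable [OpensMeasurableSpace E]

theorem le_measure_closedBall_massRadius (μ : Measure E) [IsProbabilityMeasure μ] {q : ℝ}
    (hq : q < 1) (z : E) : q ≤ μ.real (Metric.closedBall z (massRadius μ q z)) := by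
  set R := massRadius μ q z with hR
  have hgt : ∀ r, R < r → q ≤ μ.real (Metric.closedBall z r) := by
    intro r hr
    obtain ⟨r', hr', hlt⟩ := exists_lt_of_csInf_lt (massRadius_nonempty μ hq z) hr
    exact hr'.2.trans (measureReal_mono (Metric.closedBall_subset_closedBall hlt.le))
  have hinter : Metric.closedBall z R = ⋂ n : ℕ, Metric.closedBall z (R + 1 / ((n : ℝ) + 1)) := by
    ext a
    simp only [Metric.mem_closedBall, Set.mem_iInter]
    constructor
    · intro h n
      have : (0 : ℝ) ≤ 1 / ((n : ℝ) + 1) := by positivity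
      linarith
    · intro h
      have hlim : Filter.Tendsto (fun n : ℕ => R + 1 / ((n : ℝ) + 1)) Filter.atTop
          (nhds (R + 0)) := tendsto_one_div_add_atTop_nhds_zero_nat.const_add R
      rw [add_zero] at hlim
      exact ge_of_tendsto' hlim h
  have h1 := tendsto_measure_iInter_atTop (μ := μ)
    (s := fun n : ℕ => Metric.closedBall z (R + 1 / ((n : ℝ) + 1)))
    (fun n => Metric.isClosed_closedBall.measurableSet.nullMeasurableSet)
    (fun a b hab => Metric.closedBall_subset_closedBall (by gcongr))
    ⟨0, measure_ne_top _ _⟩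
  rw [← hinter] at h1
  refine ge_of_tendsto' ((ENNReal.tendsto_toReal (measure_ne_top _ _)).comp h1) fun n => ?_
  exact hgt _ (by linarith [show (0 : ℝ) < 1 / ((n : ℝ) + 1) by positivity])

theorem continuous_massRadius (μ : Measure E) [IsProbabilityMeasure μ] {q : ℝ} (hq : q < 1) :
    Continuous (massRadius μ q) := by
  refine (LipschitzWith.of_le_add fun z z' => ?_).continuous
  refine csInf_le (massRadius_bddBelow μ q z)
    ⟨add_nonneg (massRadius_nonneg μ q z') dist_nonneg, ?_⟩
  refine (le_measure_closedBall_massRadius μ hq z').trans (measureReal_mono ?_)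
  exact Metric.closedBall_subset_closedBall' (by rw [dist_comm])

theorem abs_sub_le_of_dist_le_massRadius {d : ℕ} {𝒳 : Set (Inst d)} {μ : Measure (Inst d)}
    [IsProbabilityMeasure μ] {η : Inst d → ℝ} {α L q : ℝ} (h : IsSmoothRegression 𝒳 μ η α L)
    (hL : 0 ≤ L) (hα : 0 ≤ α) (hq : 0 < q) {z z' : Inst d} (hz : z ∈ 𝒳 ∩ μ.support)
    (hz' : z' ∈ 𝒳 ∩ μ.support) (hd : dist z z' ≤ massRadius μ q z) :
    |η z - η z'| ≤ L * q ^ (α / (d : ℝ)) := by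
  refine (h z hz z' hz').trans (mul_le_mul_of_nonneg_left ?_ hL)
  refine Real.rpow_le_rpow measureReal_nonneg ?_ (by positivity)
  exact (measureReal_mono (Metric.ball_subset_ball hd)).trans (measure_ball_massRadius_le μ hq z)

end MassRadius

/-! ### The excess risk -/

section Risk

open scoped Classical

variable {d : ℕ} {P : Measure (Inst d × Bool)} {η : Inst d → ℝ}

theorem integrable_regression [IsProbabilityMeasure P] (h : IsRegressionFunction P η) :
    Integrable η P.fst :=
  Integrable.of_mem_Icc 0 1 h.measurable.aemeasurable (Filter.Eventually.of_forall h.mem_Icc)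

theorem measureReal_prod_true [IsProbabilityMeasure P] (h : IsRegressionFunction P η)
    {A : Set (Inst d)} (hA : MeasurableSet A) : P.real (A ×ˢ {true}) = ∫ x in A, η x ∂P.fst := by
  rw [measureReal_def, h.condProb A hA, integral_eq_lintegral_of_nonneg_ae
    (Filter.Eventually.of_forall fun x => (h.mem_Icc x).1) h.measurable.aestronglyMeasurable]

theorem risk_eq [IsProbabilityMeasure P] (h : IsRegressionFunction P η) {f : Inst d → Bool}
    (hf : Measurable f) :
    risk P f = ∫ x, η x + {x | f x = true}.indicator (fun x => 1 - 2 * η x) x ∂P.fst := by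
  have hF : MeasurableSet {x | f x = true} := hf (MeasurableSet.singleton true)
  have hη := integrable_regression h
  set F := {x | f x = true} with hFdef
  have hset : {p : Inst d × Bool | f p.1 ≠ p.2} =
      Fᶜ ×ˢ {true} ∪ (F ×ˢ Set.univ) \ (F ×ˢ {true}) := by
    ext ⟨x, b⟩
    cases b <;> cases hx : f x <;> simp [hFdef, hx]
  have hdisj : Disjoint (Fᶜ ×ˢ {true}) ((F ×ˢ (Set.univ : Set Bool)) \ (F ×ˢ {true})) := by
    rw [Set.disjoint_left]
    rintro ⟨x, b⟩ h1 h2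
    exact h1.1 h2.1.1
  have ht : MeasurableSet ({true} : Set Bool) := MeasurableSet.singleton _
  have hint : Integrable (fun x => 1 - 2 * η x) P.fst :=
    (integrable_const _).sub (hη.const_mul 2)
  have hsplit : ∫ x in F, 1 - 2 * η x ∂P.fst = ∫ x in F, (1 : ℝ) ∂P.fst - 2 * ∫ x in F, η x ∂P.fst := by
    rw [← integral_const_mul]
    exact integral_sub (integrable_const _) (hη.const_mul 2).integrableOn
  rw [risk, hset, measureReal_union hdisj ((hF.prod MeasurableSet.univ).diff (hF.prod ht)),
    measureReal_sdiff (Set.prod_mono_right (Set.subset_univ _)) (hF.prod ht),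
    measureReal_prod_true h hF.compl, measureReal_prod_true h hF,
    integral_add hη (hint.indicator hF), integral_indicator hF, hsplit]
  have h1 := integral_add_compl hF hη
  have h2 : P.real (F ×ˢ Set.univ) = P.fst.real F := by
    rw [measureReal_def, measureReal_def, Measure.fst_apply hF, Set.prod_univ]
  have h3 : ∫ x in F, (1 : ℝ) ∂P.fst = P.fst.real F := by simp
  rw [h2, h3]
  linarith

theorem measurable_bayesClassifier (hη : Measurable η) : Measurable (bayesClassifier η) := by
  refine measurable_to_bool ?_
  have : bayesClassifier η ⁻¹' {true} = {x | 1 / 2 ≤ η x} := by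
    ext x; simp [bayesClassifier]
  rw [this]
  exact measurableSet_le measurable_const hη

/-- If a classifier differs from the Bayes classifier only at points of margin less than `Δ` and
in the set `V`, then its excess risk is at most `2 * Δ * P_X(margin < Δ) + P_X(V)`. -/
theorem excessRisk_le [IsProbabilityMeasure P] (h : IsRegressionFunction P η) {f : Inst d → Bool}
    (hf : Measurable f) {V : Set (Inst d)} (hV : MeasurableSet V) {Δ : ℝ}
    (hfV : ∀ᵐ x ∂P.fst, x ∉ V → Δ ≤ |η x - 1 / 2| → f x = bayesClassifier η x) :
    excessRisk P η f ≤ 2 * Δ * P.fst.real {x | |η x - 1 / 2| < Δ} + P.fst.real V := by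
  have hη := integrable_regression h
  have hb := measurable_bayesClassifier h.measurable
  have hF : MeasurableSet {x | f x = true} := hf (MeasurableSet.singleton true)
  have hB : MeasurableSet {x | bayesClassifier η x = true} := hb (MeasurableSet.singleton true)
  have hM : MeasurableSet {x | |η x - 1 / 2| < Δ} :=
    measurableSet_lt (continuous_abs.measurable.comp (h.measurable.sub_const _)) measurable_const
  have hint : Integrable (fun x => 1 - 2 * η x) P.fst :=
    (integrable_const _).sub (hη.const_mul 2)
  have hsub := integral_sub (hη.add (hint.indicator hF)) (hη.add (hint.indicator hB))
  simp only [Pi.add_apply] at hsub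
  rw [excessRisk, risk_eq h hf, risk_eq h hb, ← hsub]
  have hR : 2 * Δ * P.fst.real {x | |η x - 1 / 2| < Δ} + P.fst.real V =
      ∫ x, {x | |η x - 1 / 2| < Δ}.indicator (fun _ => 2 * Δ) x + V.indicator (fun _ => 1) x
        ∂P.fst := by
    rw [integral_add ((integrable_const _).indicator hM) ((integrable_const _).indicator hV),
      integral_indicator_const _ hM, integral_indicator_const _ hV]
    simp [mul_comm]
  rw [hR]
  refine integral_mono_ae ((hη.add (hint.indicator hF)).sub (hη.add (hint.indicator hB)))
    (((integrable_const _).indicator hM).add ((integrable_const _).indicator hV)) ?_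
  filter_upwards [hfV] with x hx
  have hIcc := h.mem_Icc x
  simp only [Set.indicator_apply, Set.mem_ofPred_eq]
  by_cases hm : |η x - 1 / 2| < Δ
  · have h1 := abs_lt.1 hm
    have h2 : 0 < Δ := (abs_nonneg _).trans_lt hm
    rw [if_pos hm]
    split_ifs <;> linarith [hIcc.1, hIcc.2, h1.1, h1.2]
  · rw [if_neg hm]
    by_cases hxV : x ∈ V
    · rw [if_pos hxV]
      split_ifs <;> linarith [hIcc.1, hIcc.2]
    · simp [hx hxV (not_lt.1 hm), hxV]

theorem measurable_oneNN {w : ℕ} (x : Fin w → Inst d) (S : Fin w → Option Bool) :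
    Measurable (oneNN x S) := by
  have hN : ∀ i, MeasurableSet {z | IsNearest x S z i} := by
    intro i
    simp only [IsNearest, measurableSet_setOfPred]
    refine Measurable.and measurable_const (Measurable.forall fun j => ?_)
    refine Measurable.imp measurable_const ?_
    exact measurableSet_setOfPred.1 (measurableSet_le (by fun_prop) (by fun_prop))
  refine measurable_to_bool ?_
  have : oneNN x S ⁻¹' {true} = {z | ∃ i, IsNearest x S z i ∧ (∀ j < i, ¬ IsNearest x S z j) ∧
      S i = some true} := by
    ext z; simp [oneNN]
  rw [this, measurableSet_setOfPred]
  refine Measurable.exists fun i => ?_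
  refine (measurableSet_setOfPred.1 (hN i)).and (Measurable.and ?_ measurable_const)
  refine Measurable.forall fun j => Measurable.imp measurable_const ?_
  exact (measurableSet_setOfPred.1 (hN j)).not

end Risk

/-! ### The probability of a good pool -/

section GoodEvent

open scoped Classical ENNReal

theorem measurable_card_filter {Ω ι : Type*} [MeasurableSpace Ω] (I : Finset ι)
    {Q : Ω → ι → Prop} (hQ : ∀ i, MeasurableSet {a | Q a i}) :
    Measurable fun a => (I.filter (Q a)).card := by
  have : (fun a => (I.filter (Q a)).card) = fun a => ∑ i ∈ I, {a | Q a i}.indicator 1 a := by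
    ext a
    rw [Finset.card_eq_sum_ones, Finset.sum_filter]
    simp [Set.indicator_apply]
  rw [this]
  exact Finset.measurable_sum _ fun i _ => measurable_one.indicator (hQ i)

namespace Schedule

variable {w d : ℕ} (p : Schedule w)

/-- The first `t` points of level `j`. -/
noncomputable def prefixOf (j t : ℕ) : Finset (Fin w) :=
  Finset.univ.filter fun i => p.level i = j ∧ p.pos i < t

theorem card_prefixOf {j t : ℕ} (hj : j ≤ p.J) (ht : t ≤ p.size) : (p.prefixOf j t).card = t := by
  rcases Nat.eq_zero_or_pos p.size with h0 | h0
  · have : t = 0 := by omega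
    subst this; simp [prefixOf]
  have hw : ∀ a < t, j * p.size + a < w := by
    intro a ha
    calc j * p.size + a < j * p.size + p.size := by omega
      _ = (j + 1) * p.size := by ring
      _ ≤ (p.J + 1) * p.size := Nat.mul_le_mul_right _ (by omega)
      _ ≤ w := by rw [mul_comm]; exact Nat.div_mul_le_self _ _
  refine (Finset.card_bij' (s := Finset.range t) (t := p.prefixOf j t)
    (fun a ha => ⟨j * p.size + a, hw a (Finset.mem_range.1 ha)⟩) (fun i _ => p.pos i)
    ?_ ?_ ?_ ?_).symm.trans (Finset.card_range t)
  · intro a ha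
    have ha' : a < p.size := (Finset.mem_range.1 ha).trans_le ht
    have h1 : (j * p.size + a) / p.size = j := by
      rw [mul_comm, Nat.mul_add_div h0, Nat.div_eq_of_lt ha', add_zero]
    have h2 : (j * p.size + a) % p.size = a := by
      rw [mul_comm, Nat.mul_add_mod, Nat.mod_eq_of_lt ha']
    refine Finset.mem_filter.2 ⟨Finset.mem_univ _, h1, ?_⟩
    exact h2.trans_lt (Finset.mem_range.1 ha)
  · intro i hi
    exact Finset.mem_range.2 (Finset.mem_filter.1 hi).2.2
  · intro a ha
    have ha' : a < p.size := (Finset.mem_range.1 ha).trans_le ht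
    simp only [pos]
    rw [mul_comm, Nat.mul_add_mod, Nat.mod_eq_of_lt ha']
  · intro i hi
    have hl := (Finset.mem_filter.1 hi).2.1
    ext
    simp only [← hl, level, pos]
    exact Nat.div_add_mod' _ _

theorem card_labelBlock : p.size ≤ p.labelBlock.card := by
  rw [← p.card_prefixOf (Nat.zero_le _) le_rfl]
  refine Finset.card_le_card fun i hi => ?_
  simp only [prefixOf, labelBlock, Finset.mem_filter, Finset.mem_univ, true_and] at hi ⊢
  exact hi.1

/-- The set of candidate centers. -/
noncomputable def centers : Finset (Fin w) := Finset.univ.filter p.IsCenter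

theorem card_centers_le : p.centers.card ≤ p.J * p.M := by
  have h : p.centers.card ≤ (Finset.Icc 1 p.J ×ˢ Finset.range p.M).card := by
    refine Finset.card_le_card_of_injOn (fun c => (p.level c, p.pos c)) ?_ ?_
    · intro c hc
      have hc := (Finset.mem_filter.1 hc).2
      simpa using ⟨⟨hc.1, hc.2.1⟩, hc.2.2⟩
    · intro c _ c' _ h
      simp only [Prod.mk.injEq] at h
      ext
      rw [← Nat.div_add_mod (c : ℕ) p.size, ← Nat.div_add_mod (c' : ℕ) p.size]
      have h1 : (c : ℕ) / p.size = (c' : ℕ) / p.size := h.1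
      have h2 : (c : ℕ) % p.size = (c' : ℕ) % p.size := h.2
      rw [h1, h2]
  simpa using h

theorem measurableSet_mem_nearest (c i : Fin w) (k : ℕ) :
    MeasurableSet {x : Fin w → Inst d | i ∈ p.nearest x (x c) k} := by
  have h : Measurable fun x : Fin w → Inst d =>
      (p.labelBlock.filter fun i' => Closer x (x c) i' i).card := by
    refine measurable_card_filter _ fun i' => ?_
    have h1 : Measurable fun x : Fin w → Inst d => dist (x c) (x i') := by fun_prop
    have h2 : Measurable fun x : Fin w → Inst d => dist (x c) (x i) := by fun_prop
    exact (measurableSet_lt h1 h2).union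
      ((measurableSet_eq_fun h1 h2).inter (MeasurableSet.const _))
  have : {x : Fin w → Inst d | i ∈ p.nearest x (x c) k} =
      {x | i ∈ p.labelBlock} ∩ {x | (p.labelBlock.filter fun i' => Closer x (x c) i' i).card < k} := by
    ext x; simp [nearest]
  rw [this]
  exact (MeasurableSet.const _).inter (measurableSet_lt h measurable_const)

/-- The label averages at the centers are close to their means, with high probability. -/
theorem pi_noise_le {P : Measure (Inst d × Bool)} [IsProbabilityMeasure P] {η : Inst d → ℝ}
    (h : IsRegressionFunction P η) (c : Fin w) :
    Measure.pi (fun _ : Fin w => P) {D |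
      p.labels (p.level c) * ((1 / 2 : ℝ) ^ p.level c / 8) <
      |(((p.nearest (fun i => (D i).1) (D c).1 (p.labels (p.level c))).filter
        fun i => (D i).2 = true).card : ℝ) -
        ∑ i ∈ p.nearest (fun i => (D i).1) (D c).1 (p.labels (p.level c)), η (D i).1|} ≤
      ENNReal.ofReal (2 * Real.exp (-(p.Λ / 32))) := by
  refine (pi_label_deviation_le h
    (fun x : Fin w → Inst d => p.nearest x (x c) (p.labels (p.level c)))
    (fun i => p.measurableSet_mem_nearest c i _) (k := p.labels (p.level c))
    (fun x => (p.card_nearest x (x c) _).trans_le (min_le_left _ _))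
    (θ := (1 / 2 : ℝ) ^ p.level c / 8) (by positivity)).trans (le_of_eq ?_)
  have : ((4 : ℝ) ^ p.level c) * ((1 / 2 : ℝ) ^ p.level c) ^ 2 = 1 := by
    rw [← pow_mul, mul_comm (p.level c) 2, pow_mul, ← mul_pow]; norm_num
  congr 4
  simp only [labels, Nat.cast_mul, Nat.cast_pow, Nat.cast_ofNat]
  linear_combination (p.Λ : ℝ) / 32 * this

variable (μ : Measure (Inst d)) [IsProbabilityMeasure μ]

/-- The label block is dense around a center, with high probability. -/
theorem pi_not_dense_le {q : ℝ} (hq0 : 0 ≤ q) (hq : q < 1) {c : Fin w} (hc : 1 ≤ p.level c) {k : ℕ}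
    (hk : 4 * (k : ℝ) ≤ q * p.size) (hΛ : p.Λ ≤ k) :
    Measure.pi (fun _ : Fin w => μ) {x |
      (p.labelBlock.filter fun i => dist (x c) (x i) ≤ massRadius μ q (x c)).card < k} ≤
      ENNReal.ofReal (Real.exp (-p.Λ)) := by
  have hr := (continuous_massRadius μ hq).measurable
  have hS : MeasurableSet {a : (Fin w → Inst d) × Inst d |
      (p.labelBlock.filter fun i => dist a.2 (a.1 i) ≤ massRadius μ q a.2).card < k} := by
    refine measurableSet_lt (measurable_card_filter _ fun i => ?_) measurable_const
    exact measurableSet_le (by fun_prop) (hr.comp measurable_snd)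
  refine pi_mem_self_le μ c hS (fun x z z' => ?_) fun z => ?_
  · simp only [Set.mem_ofPred_eq]
    refine iff_of_eq (congrArg (fun a => a < k) (congrArg Finset.card
      (Finset.filter_congr fun i hi => ?_)))
    rw [Function.update_of_ne]
    rintro rfl
    have := (Finset.mem_filter.1 hi).2
    omega
  · have h := pi_card_lt_le μ (A := Metric.closedBall z (massRadius μ q z))
      Metric.isClosed_closedBall.measurableSet (le_measure_closedBall_massRadius μ hq z)
      p.labelBlock k
    simp only [Metric.mem_closedBall'] at h
    refine h.trans (ENNReal.ofReal_le_ofReal (Real.exp_le_exp.2 ?_))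
    have h1 : (p.size : ℝ) ≤ p.labelBlock.card := by exact_mod_cast p.card_labelBlock
    have h2 : (p.Λ : ℝ) ≤ k := by exact_mod_cast hΛ
    nlinarith

/-- A fixed point is near the net of level `j`, with high probability. -/
theorem pi_not_near_le {q : ℝ} (hq : q < 1) {j t : ℕ} (hj : j ≤ p.J) (ht : t ≤ p.size)
    (hqt : p.Λ ≤ q * t) (z : Inst d) :
    Measure.pi (fun _ : Fin w => μ)
      {x | ∀ i ∈ p.prefixOf j t, ¬ dist z (x i) ≤ massRadius μ q z} ≤
      ENNReal.ofReal (Real.exp (-p.Λ)) := by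
  have h := pi_forall_notMem_le μ (A := Metric.closedBall z (massRadius μ q z))
    Metric.isClosed_closedBall.measurableSet (le_measure_closedBall_massRadius μ hq z)
    (p.prefixOf j t)
  simp only [Metric.mem_closedBall', p.card_prefixOf hj ht] at h
  refine h.trans (ENNReal.ofReal_le_ofReal (Real.exp_le_exp.2 ?_))
  linarith

theorem measurableSet_not_near {q : ℝ} (hq : q < 1) (I : Finset (Fin w)) :
    MeasurableSet {a : (Fin w → Inst d) × Inst d |
      ∀ i ∈ I, ¬ dist a.2 (a.1 i) ≤ massRadius μ q a.2} := by
  have hr := (continuous_massRadius μ hq).measurable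
  refine measurableSet_setOfPred.2 (Measurable.forall fun i => ?_)
  refine Measurable.imp measurable_const (Measurable.not ?_)
  exact measurableSet_setOfPred.1 (measurableSet_le (by fun_prop) (hr.comp measurable_snd))

/-- A center is near the net of another level `j`, with high probability. -/
theorem pi_center_not_near_le {q : ℝ} (hq : q < 1) {j t : ℕ} (hj : j ≤ p.J) (ht : t ≤ p.size)
    (hqt : p.Λ ≤ q * t) {c : Fin w} (hc : j < p.level c) :
    Measure.pi (fun _ : Fin w => μ)
      {x | ∀ i ∈ p.prefixOf j t, ¬ dist (x c) (x i) ≤ massRadius μ q (x c)} ≤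
      ENNReal.ofReal (Real.exp (-p.Λ)) := by
  refine pi_mem_self_le μ c (measurableSet_not_near μ hq (p.prefixOf j t)) (fun x z z' => ?_)
    fun z => p.pi_not_near_le μ hq hj ht hqt z
  simp only [Set.mem_ofPred_eq]
  refine forall_congr' fun i => imp_congr_right fun hi => ?_
  rw [Function.update_of_ne]
  rintro rfl
  have := (Finset.mem_filter.1 hi).2.1
  omega

/-- The set of points that are not near the net of some level `j ≤ s`. -/
def notNear (x : Fin w → Inst d) (q : ℕ → ℝ) (T : ℕ → ℕ) (s : ℕ) : Set (Inst d) :=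
  {z | ∃ j ∈ Finset.Icc 1 s, ∀ i ∈ p.prefixOf j (T j), ¬ dist z (x i) ≤ massRadius μ (q j) z}

theorem measurableSet_notNear_prod {q : ℕ → ℝ} {T : ℕ → ℕ} {s : ℕ}
    (hq : ∀ j, 1 ≤ j → j ≤ s → q j < 1) :
    MeasurableSet {a : (Fin w → Inst d) × Inst d | a.2 ∈ p.notNear μ a.1 q T s} := by
  have : {a : (Fin w → Inst d) × Inst d | a.2 ∈ p.notNear μ a.1 q T s} =
      ⋃ j ∈ Finset.Icc 1 s, {a : (Fin w → Inst d) × Inst d |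
        ∀ i ∈ p.prefixOf j (T j), ¬ dist a.2 (a.1 i) ≤ massRadius μ (q j) a.2} := by
    ext a; simp [notNear]
  rw [this]
  refine Finset.measurableSet_biUnion _ fun j hj => ?_
  obtain ⟨h1, h2⟩ := Finset.mem_Icc.1 hj
  exact measurableSet_not_near μ (hq j h1 h2) _

/-- The mass of the points that are not near the nets is small, with high probability. -/
theorem pi_notNear_le {q : ℕ → ℝ} {T : ℕ → ℕ} {s : ℕ} (hs : s ≤ p.J)
    (hq : ∀ j, 1 ≤ j → j ≤ s → q j < 1) (hT : ∀ j, 1 ≤ j → j ≤ s → T j ≤ p.size)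
    (hqT : ∀ j, 1 ≤ j → j ≤ s → p.Λ ≤ q j * T j) {ε : ℝ} (hε : 0 < ε) :
    Measure.pi (fun _ : Fin w => μ) {x | ε / 2 < μ.real (p.notNear μ x q T s)} ≤
      ENNReal.ofReal (2 / ε * (s * Real.exp (-p.Λ))) := by
  set ν := Measure.pi fun _ : Fin w => μ with hν
  set S := {a : (Fin w → Inst d) × Inst d | a.2 ∈ p.notNear μ a.1 q T s} with hS
  have hSm : MeasurableSet S := p.measurableSet_notNear_prod μ hq
  have h1 : (ν.prod μ) S ≤ ENNReal.ofReal (s * Real.exp (-p.Λ)) := by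
    rw [Measure.prod_apply_symm hSm]
    refine (lintegral_mono (g := fun _ => ENNReal.ofReal (s * Real.exp (-p.Λ))) fun z => ?_).trans
      (by simp)
    have : (fun x => (x, z)) ⁻¹' S = ⋃ j ∈ Finset.Icc 1 s,
        {x : Fin w → Inst d |
          ∀ i ∈ p.prefixOf j (T j), ¬ dist z (x i) ≤ massRadius μ (q j) z} := by
      ext x; simp [hS, notNear]
    rw [this]
    refine (measure_biUnion_finset_le _ _).trans ((Finset.sum_le_card_nsmul _ _
      (ENNReal.ofReal (Real.exp (-p.Λ))) fun j hj => ?_).trans (le_of_eq ?_))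
    · obtain ⟨h1, h2⟩ := Finset.mem_Icc.1 hj
      exact p.pi_not_near_le μ (hq j h1 h2) (h2.trans hs) (hT j h1 h2) (hqT j h1 h2) z
    · rw [Nat.card_Icc, Nat.add_sub_cancel, ← ENNReal.ofReal_nsmul, nsmul_eq_mul]
  rw [Measure.prod_apply hSm] at h1
  have h2 := mul_meas_ge_le_lintegral (μ := ν) (measurable_measure_prodMk_left (ν := μ) hSm)
    (ENNReal.ofReal (ε / 2))
  have h3 : ν {x | ε / 2 < μ.real (p.notNear μ x q T s)} ≤
      ν {x | ENNReal.ofReal (ε / 2) ≤ μ (Prod.mk x ⁻¹' S)} := by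
    refine measure_mono fun x hx => ?_
    exact (ENNReal.ofReal_le_iff_le_toReal (measure_ne_top _ _)).2 (le_of_lt hx)
  rw [← mul_one (2 / ε * _), mul_assoc, ENNReal.ofReal_mul (by positivity)]
  have h4 := (mul_le_mul_right h3 (ENNReal.ofReal (ε / 2))).trans (h2.trans h1)
  have h5 : ENNReal.ofReal (2 / ε) * ENNReal.ofReal (ε / 2) = 1 := by
    rw [← ENNReal.ofReal_mul (by positivity)]
    rw [show 2 / ε * (ε / 2) = 1 by field_simp]; simp
  calc ν {x | ε / 2 < μ.real (p.notNear μ x q T s)}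
      = ENNReal.ofReal (2 / ε) * (ENNReal.ofReal (ε / 2) *
          ν {x | ε / 2 < μ.real (p.notNear μ x q T s)}) := by rw [← mul_assoc, h5, one_mul]
    _ ≤ _ := by
      rw [mul_one]
      exact mul_le_mul_right h4 _

/-- The number of net points of small margin is not much larger than its mean, with high
probability. -/
theorem pi_many_le {η : Inst d → ℝ} (hη : Measurable η) {j t : ℕ} (hj : j ≤ p.J)
    (ht : t ≤ p.size) {a b : ℝ} (hb : μ.real {z | |η z - 1 / 2| < a} ≤ b) {N : ℕ}
    (hN : 2 * b * t + p.Λ ≤ N) :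
    Measure.pi (fun _ : Fin w => μ) {x | N < (Finset.univ.filter fun i =>
      (p.level i = j ∧ p.pos i < t) ∧ |η (x i) - 1 / 2| < a).card} ≤
      ENNReal.ofReal (Real.exp (-p.Λ)) := by
  have hA : MeasurableSet {z | |η z - 1 / 2| < a} :=
    measurableSet_lt (continuous_abs.measurable.comp (hη.sub_const _)) measurable_const
  refine (measure_mono ?_).trans (pi_lt_card_le μ hA hb (p.prefixOf j t) p.Λ)
  intro x hx
  simp only [Set.mem_ofPred_eq] at hx ⊢
  rw [p.card_prefixOf hj ht, prefixOf, Finset.filter_filter]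
  exact hN.trans_lt (by exact_mod_cast hx)

end Schedule

end GoodEvent

/-! ### The risk bound in terms of the parameters of the learner -/

section RiskBound

open scoped Classical ENNReal

theorem measure_biUnion_le_of_le {Ω ι : Type*} [MeasurableSpace Ω] (ν : Measure Ω) (I : Finset ι)
    (B : ι → Set Ω) {N : ℕ} (hN : I.card ≤ N) {b : ℝ} (hb : 0 ≤ b)
    (h : ∀ i ∈ I, ν (B i) ≤ ENNReal.ofReal b) : ν (⋃ i ∈ I, B i) ≤ ENNReal.ofReal (N * b) := by
  refine (measure_biUnion_finset_le _ _).trans ((Finset.sum_le_card_nsmul _ _ _ h).trans ?_)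
  rw [← ENNReal.ofReal_nsmul, nsmul_eq_mul]
  apply ENNReal.ofReal_le_ofReal
  gcongr

namespace Schedule

variable {w d : ℕ} (p : Schedule w) {𝒳 : Set (Inst d)} {P : Measure (Inst d × Bool)}
  {η : Inst d → ℝ} {α L β C : ℝ}

/-- The learner with the parameters `p` has excess risk at most `ε` with probability at least
`1 - δ`, if its parameters satisfy the following inequalities for some final level `s`, some
masses `q j` of neighbourhoods and some sizes `T j` of nets. -/
theorem excessRiskBound_learner (hP : SmoothNoiseClass 𝒳 α L β C P η) (hL : 0 ≤ L) (hα : 0 ≤ α)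
    {s : ℕ} (hs : 1 ≤ s) (hsJ : s ≤ p.J) (hΛ : 0 < p.Λ) {q : ℕ → ℝ} {T : ℕ → ℕ}
    (hq0 : ∀ j, 1 ≤ j → j ≤ s → 0 < q j) (hq1 : ∀ j, 1 ≤ j → j ≤ s → q j < 1)
    (hqL : ∀ j, 1 ≤ j → j ≤ s → L * q j ^ (α / (d : ℝ)) ≤ (1 / 2 : ℝ) ^ j / 8)
    (hTM : ∀ j, 1 ≤ j → j ≤ s → T j ≤ p.M) (hTs : ∀ j, 1 ≤ j → j ≤ s → T j ≤ p.size)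
    (hqT : ∀ j, 1 ≤ j → j ≤ s → p.Λ ≤ q j * T j)
    (hdense : 4 * (p.labels s : ℝ) ≤ q s * p.size)
    (hbudget : ∀ j, 1 ≤ j → j ≤ s →
      2 * P.fst.real {z | |η z - 1 / 2| < 7 * (1 / 2 : ℝ) ^ j} * T j + p.Λ ≤ p.budget j)
    {ε δ : ℝ} (hε : 0 < ε) (hε1 : ε ≤ 1)
    (hprob : 20 * (p.J : ℝ) ^ 2 * (p.M + 1) * Real.exp (-(p.Λ / 32)) ≤ ε * δ)
    (hrisk : 2 * (4 * (1 / 2 : ℝ) ^ s) * P.fst.real {z | |η z - 1 / 2| < 4 * (1 / 2 : ℝ) ^ s} ≤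
      ε / 2) :
    ExcessRiskBound (p.learner d) P η ε δ := by
  have := hP.isProbabilityMeasure
  have hη := hP.regression
  set μ := P.fst with hμ
  set G := 𝒳 ∩ μ.support with hG
  have hGae : ∀ᵐ z ∂μ, z ∈ G := by
    filter_upwards [hP.ae_mem, μ.support_mem_ae] with z h1 h2 using ⟨h1, h2⟩
  set r : ℕ → Inst d → ℝ := fun j => massRadius μ (q j) with hr
  have hreg : p.Regular η G r s T :=
    ⟨hη.mem_Icc, fun j h1 h2 z hz z' hz' hd =>
      (abs_sub_le_of_dist_le_massRadius hP.smooth hL hα (hq0 j h1 h2) hz hz' hd).trans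
        (hqL j h1 h2), hs, hsJ, hTM, hΛ⟩
  -- the bad events
  let X : (Fin w → Inst d × Bool) → Fin w → Inst d := fun D i => (D i).1
  let B0 : Set (Fin w → Inst d × Bool) := {D | ¬ ∀ i, X D i ∈ G}
  let B1 : Fin w → Set (Fin w → Inst d × Bool) := fun c => {D |
      p.labels (p.level c) * ((1 / 2 : ℝ) ^ p.level c / 8) <
      |(((p.nearest (fun i => (D i).1) (D c).1 (p.labels (p.level c))).filter
        fun i => (D i).2 = true).card : ℝ) -
        ∑ i ∈ p.nearest (fun i => (D i).1) (D c).1 (p.labels (p.level c)), η (D i).1|}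
  let B2 : Fin w → Set (Fin w → Inst d) := fun c => {x |
      (p.labelBlock.filter fun i => dist (x c) (x i) ≤ massRadius μ (q s) (x c)).card < p.labels s}
  let B3 : Fin w → ℕ → Set (Fin w → Inst d) := fun c j => {x | j < p.level c ∧
      ∀ i ∈ p.prefixOf j (T j), ¬ dist (x c) (x i) ≤ massRadius μ (q j) (x c)}
  let B4 : Set (Fin w → Inst d) := {x | ε / 2 < μ.real (p.notNear μ x q T s)}
  let B5 : ℕ → Set (Fin w → Inst d) := fun j => {x | p.budget j < (Finset.univ.filter fun i =>
      (p.level i = j ∧ p.pos i < T j) ∧ |η (x i) - 1 / 2| < 7 * (1 / 2 : ℝ) ^ j).card}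
  have hsub : {D | ε < excessRisk P η ((p.learner d).classifier D)} ⊆
      B0 ∪ (⋃ c ∈ p.centers, B1 c) ∪ X ⁻¹' ((⋃ c ∈ p.centers, B2 c) ∪
        (⋃ c ∈ p.centers, ⋃ j ∈ Finset.Icc 1 s, B3 c j) ∪ B4 ∪ ⋃ j ∈ Finset.Icc 1 s, B5 j) := by
    intro D hD
    by_contra hnot
    simp only [Set.mem_union, Set.mem_preimage, not_or, Set.mem_iUnion, not_exists] at hnot
    obtain ⟨⟨h0, h1⟩, ⟨⟨h2, h3⟩, h4⟩, h5⟩ := hnot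
    have hgood : p.GoodPool (X D) (fun i => (D i).2) η G r s T := by
      have hcen : ∀ c, p.IsCenter c → c ∈ p.centers := fun c hc =>
        Finset.mem_filter.2 ⟨Finset.mem_univ _, hc⟩
      refine ⟨not_not.1 h0, fun c hc => not_lt.1 (h1 c (hcen c hc)),
        fun c hc => not_lt.1 (h2 c (hcen c hc)), fun c hc j hj1 hjs hjc => ?_,
        fun j hj1 hjs => not_lt.1 (h5 j (Finset.mem_Icc.2 ⟨hj1, hjs⟩))⟩
      by_contra hn
      refine h3 c (hcen c hc) j (Finset.mem_Icc.2 ⟨hj1, hjs⟩) ⟨hjc, fun i hi hd => hn ?_⟩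
      obtain ⟨hi1, hi2⟩ := (Finset.mem_filter.1 hi).2
      exact ⟨i, hi1, hi2, hd⟩
    have hV : MeasurableSet (p.notNear μ (X D) q T s) :=
      measurable_prodMk_left (p.measurableSet_notNear_prod μ hq1)
    refine absurd hD (not_lt.2 ((excessRisk_le (Δ := 4 * (1 / 2 : ℝ) ^ s) hη
      (measurable_oneNN _ _) hV ?_).trans ?_))
    · filter_upwards [hGae] with z hz hzV hm
      refine oneNN_eq hreg hgood hz (fun j hj1 hjs => ?_) hm
      by_contra hn
      refine hzV ⟨j, Finset.mem_Icc.2 ⟨hj1, hjs⟩, fun i hi hd => hn ?_⟩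
      obtain ⟨hi1, hi2⟩ := (Finset.mem_filter.1 hi).2
      exact ⟨i, hi1, hi2, hd⟩
    · have : μ.real (p.notNear μ (X D) q T s) ≤ ε / 2 := not_lt.1 h4
      linarith
  set e := Real.exp (-(p.Λ / 32 : ℝ)) with he
  have he0 : 0 ≤ e := Real.exp_nonneg _
  have hexp : Real.exp (-(p.Λ : ℝ)) ≤ e := by
    apply Real.exp_le_exp.2
    have : (0 : ℝ) ≤ p.Λ := Nat.cast_nonneg _
    linarith
  have hexp' : ENNReal.ofReal (Real.exp (-(p.Λ : ℝ))) ≤ ENNReal.ofReal e :=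
    ENNReal.ofReal_le_ofReal hexp
  have hcc := p.card_centers_le
  have hclev : ∀ c ∈ p.centers, 1 ≤ p.level c := fun c hc => (Finset.mem_filter.1 hc).2.1
  have hcardJ : (Finset.Icc 1 s).card ≤ p.J := by simpa using hsJ
  have hfst : MeasurePreserving Prod.fst P μ := ⟨measurable_fst, rfl⟩
  have m0 : Measure.pi (fun _ : Fin w => P) B0 = 0 := by
    have h : ∀ᵐ D ∂Measure.pi (fun _ : Fin w => P), ∀ i, X D i ∈ G := by
      refine Filter.eventually_all.2 fun i => ?_
      have h1 : ∀ᵐ y ∂P, y.1 ∈ G := hfst.quasiMeasurePreserving.ae hGae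
      exact (Measure.quasiMeasurePreserving_eval (fun _ : Fin w => P) i).ae h1
    exact h
  have m1 : Measure.pi (fun _ : Fin w => P) (⋃ c ∈ p.centers, B1 c) ≤
      ENNReal.ofReal ((p.J * p.M : ℕ) * (2 * e)) :=
    measure_biUnion_le_of_le _ _ _ hcc (by positivity) fun c _ => p.pi_noise_le hη c
  have m2 : Measure.pi (fun _ : Fin w => μ) (⋃ c ∈ p.centers, B2 c) ≤
      ENNReal.ofReal ((p.J * p.M : ℕ) * e) :=
    measure_biUnion_le_of_le _ _ _ hcc he0 fun c hc =>
      (p.pi_not_dense_le μ (hq0 s hs le_rfl).le (hq1 s hs le_rfl) (hclev c hc) hdense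
        (Nat.le_mul_of_pos_left _ (by positivity))).trans hexp'
  have m3 : Measure.pi (fun _ : Fin w => μ) (⋃ c ∈ p.centers, ⋃ j ∈ Finset.Icc 1 s, B3 c j) ≤
      ENNReal.ofReal ((p.J * p.M : ℕ) * (p.J * e)) := by
    refine measure_biUnion_le_of_le _ _ _ hcc (by positivity) fun c hc =>
      measure_biUnion_le_of_le _ _ _ hcardJ he0 fun j hj => ?_
    obtain ⟨hj1, hjs⟩ := Finset.mem_Icc.1 hj
    by_cases hjc : j < p.level c
    · refine (measure_mono fun x hx => hx.2).trans ((p.pi_center_not_near_le μ (hq1 j hj1 hjs)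
        (hjs.trans hsJ) (hTs j hj1 hjs) (hqT j hj1 hjs) hjc).trans hexp')
    · have : B3 c j = ∅ := by
        ext x; simp [B3, hjc]
      rw [this]; simp
  have m4 : Measure.pi (fun _ : Fin w => μ) B4 ≤ ENNReal.ofReal (2 / ε * (p.J * e)) := by
    refine (p.pi_notNear_le μ hsJ hq1 hTs hqT hε).trans (ENNReal.ofReal_le_ofReal ?_)
    gcongr
  have m5 : Measure.pi (fun _ : Fin w => μ) (⋃ j ∈ Finset.Icc 1 s, B5 j) ≤
      ENNReal.ofReal (p.J * e) := by
    refine measure_biUnion_le_of_le _ _ _ hcardJ he0 fun j hj => ?_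
    obtain ⟨hj1, hjs⟩ := Finset.mem_Icc.1 hj
    exact (p.pi_many_le μ hη.measurable (hjs.trans hsJ) (hTs j hj1 hjs) le_rfl
      (hbudget j hj1 hjs)).trans hexp'
  have hX : MeasurePreserving X (Measure.pi fun _ : Fin w => P) (Measure.pi fun _ : Fin w => μ) :=
    measurePreserving_pi _ _ fun _ => hfst
  unfold ExcessRiskBound
  refine (measure_mono hsub).trans ((measure_union_le _ _).trans ((add_le_add
    ((measure_union_le _ _).trans (add_le_add m0.le m1))
    ((Measure.le_map_apply hX.measurable.aemeasurable _).trans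
      (hX.map_eq.symm ▸ (measure_union_le _ _).trans (add_le_add ((measure_union_le _ _).trans
        (add_le_add ((measure_union_le _ _).trans (add_le_add m2 m3)) m4)) m5)))).trans ?_))
  rw [zero_add]
  rw [← ENNReal.ofReal_add (by positivity) (by positivity),
    ← ENNReal.ofReal_add (by positivity) (by positivity),
    ← ENNReal.ofReal_add (by positivity) (by positivity),
    ← ENNReal.ofReal_add (by positivity) (by positivity)]
  apply ENNReal.ofReal_le_ofReal
  have hJ1 : (1 : ℝ) ≤ p.J := by exact_mod_cast hs.trans hsJ
  have hM0 : (0 : ℝ) ≤ p.M := Nat.cast_nonneg _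
  have hJJ : (p.J : ℝ) ≤ (p.J : ℝ) ^ 2 := by nlinarith
  push_cast
  rw [← mul_le_mul_iff_right₀ hε]
  refine le_trans ?_ hprob
  have h1 : ε * (2 / ε * (p.J * e)) = 2 * (p.J * e) := by field_simp
  have a1 : (p.J : ℝ) * p.M * e ≤ (p.J : ℝ) ^ 2 * (p.M + 1) * e := by gcongr; linarith
  have a2 : (p.J : ℝ) * e ≤ (p.J : ℝ) ^ 2 * (p.M + 1) * e := by
    gcongr; nlinarith
  have a3 : (p.J : ℝ) * p.M * (p.J * e) ≤ (p.J : ℝ) ^ 2 * (p.M + 1) * e := by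
    nlinarith [mul_nonneg (sq_nonneg (p.J : ℝ)) he0]
  have a4 : ∀ t : ℝ, 0 ≤ t → ε * t ≤ t := fun t ht => by nlinarith
  have b1 := a4 ((p.J : ℝ) * p.M * (2 * e)) (by positivity)
  have b2 := a4 ((p.J : ℝ) * p.M * e) (by positivity)
  have b3 := a4 ((p.J : ℝ) * p.M * (p.J * e)) (by positivity)
  have b4 := a4 ((p.J : ℝ) * e) (by positivity)
  nlinarith

end Schedule

end RiskBound

/-! ### The choice of the parameters -/

section Parameters

/-- The number of levels of the learner for the accuracy `ε`. -/
noncomputable def numLevels (C ε : ℝ) : ℕ := ⌈Real.logb 2 (16 * C / ε)⌉₊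

/-- The number of candidate centers of a level. It exceeds the sizes of all nets in the analysis,
and it is bounded in terms of `n` and `ε`, so that a huge pool does not inflate the union bound over
the centers, and with it the number of label requests. -/
noncomputable def numCenters (C ε : ℝ) (n w : ℕ) : ℕ := min n w ^ (numLevels C ε + 1)

/-- The logarithmic factor in the number of labels per center. The constant `32` comes from
Hoeffding's inequality at the accuracy `2 ^ (-j) / 8` for `4 ^ j * Λ` labels. -/
noncomputable def logFactor (C ε δ : ℝ) (n w : ℕ) : ℕ :=
  ⌈32 * Real.log (20 * (numLevels C ε : ℝ) ^ 2 * (numCenters C ε n w + 1) / (ε * δ))⌉₊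

/-- The parameters of the learner in terms of the inputs. They do not depend on `α` and `β`. -/
noncomputable def schedule (C ε δ : ℝ) (n w : ℕ) : Schedule w where
  J := numLevels C ε
  M := numCenters C ε n w
  Λ := logFactor C ε δ n w
  n := n

/-- The final level of the analysis, where `2 ^ (-s)` is of the order `ε ^ (1 / (β + 1))`. -/
theorem exists_finalLevel {C ε β : ℝ} (hC : 1 < C) (hε : 0 < ε) (hε2 : ε < 1 / 2) (hβ : 0 < β) :
    ∃ s : ℕ, 1 ≤ s ∧ s ≤ numLevels C ε ∧
      4 * (4 * C / ε) ^ (1 / (β + 1)) ≤ (2 : ℝ) ^ s ∧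
      (2 : ℝ) ^ s ≤ 8 * (4 * C / ε) ^ (1 / (β + 1)) := by
  have hx : 1 < 4 * C / ε := by rw [lt_div_iff₀ hε]; linarith
  set D := (4 * C / ε) ^ (1 / (β + 1)) with hD
  have hD1 : 1 < D := Real.one_lt_rpow hx (by positivity)
  have hDle : D ≤ 4 * C / ε := by
    have := Real.rpow_le_rpow_of_exponent_le hx.le (show 1 / (β + 1) ≤ 1 by
      rw [div_le_one (by linarith)]; linarith)
    rwa [Real.rpow_one] at this
  have hlog : 0 < Real.logb 2 (4 * D) := Real.logb_pos (by norm_num) (by linarith)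
  refine ⟨⌈Real.logb 2 (4 * D)⌉₊, Nat.ceil_pos.2 hlog, ?_, ?_, ?_⟩
  · refine Nat.ceil_le_ceil (Real.logb_le_logb_of_le (by norm_num) (by linarith) ?_)
    calc 4 * D ≤ 4 * (4 * C / ε) := by linarith
      _ = 16 * C / ε := by ring
  · rw [← Real.rpow_natCast]
    refine (Real.rpow_logb (b := 2) (by norm_num) (by norm_num) (by linarith : 0 < 4 * D)).symm.le.trans ?_
    exact Real.rpow_le_rpow_of_exponent_le (by norm_num) (Nat.le_ceil _)
  · rw [← Real.rpow_natCast]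
    have h1 := (Nat.ceil_lt_add_one hlog.le).le
    refine (Real.rpow_le_rpow_of_exponent_le (by norm_num) h1).trans ?_
    rw [Real.rpow_add (by norm_num), Real.rpow_logb (by norm_num) (by norm_num) (by linarith)]
    rw [Real.rpow_one]; linarith

theorem rpow_level_le {C ε β : ℝ} (hC : 1 < C) (hε : 0 < ε) (hβ : 0 < β) {s : ℕ}
    (hs : (2 : ℝ) ^ s ≤ 8 * (4 * C / ε) ^ (1 / (β + 1))) {e E : ℝ} (he : 0 ≤ e) (heE : e ≤ E) :
    ((2 : ℝ) ^ s) ^ e ≤ (32 * C) ^ E * (1 / ε) ^ (e / (β + 1)) := by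
  have h1 : 4 * C / ε = 4 * C * (1 / ε) := by ring
  refine (Real.rpow_le_rpow (by positivity) hs he).trans ?_
  rw [Real.mul_rpow (by norm_num) (by positivity), ← Real.rpow_mul (by positivity), h1,
    Real.mul_rpow (by positivity) (by positivity), ← mul_assoc,
    show 1 / (β + 1) * e = e / (β + 1) by ring]
  refine mul_le_mul_of_nonneg_right ?_ (by positivity)
  have h2 : (4 * C) ^ (e / (β + 1)) ≤ (4 * C) ^ e :=
    Real.rpow_le_rpow_of_exponent_le (by linarith) (div_le_self he (by linarith))
  calc (8 : ℝ) ^ e * (4 * C) ^ (e / (β + 1)) ≤ 8 ^ e * (4 * C) ^ e := by gcongr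
    _ = (32 * C) ^ e := by
      rw [← Real.mul_rpow (by norm_num) (by positivity)]; congr 1; ring
    _ ≤ (32 * C) ^ E := Real.rpow_le_rpow_of_exponent_le (by linarith) heE

theorem measure_margin_le {d : ℕ} {𝒳 : Set (Inst d)} {P : Measure (Inst d × Bool)}
    {η : Inst d → ℝ} {α L β C : ℝ} (hP : SmoothNoiseClass 𝒳 α L β C P η) (hC : 1 ≤ C)
    (hβ : 0 ≤ β) {t : ℝ} (ht : 0 < t) : P.fst.real {z | |η z - 1 / 2| < t} ≤ C * t ^ β := by
  rcases le_or_gt t 1 with h | h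
  · exact (hP.noise t ht h).le
  · have := hP.isProbabilityMeasure
    refine measureReal_le_one.trans ?_
    nlinarith [Real.one_le_rpow h.le hβ]

/-- The logarithmic factor makes the failure probabilities small. -/
theorem logFactor_spec {C ε δ : ℝ} {n w : ℕ} (hJ : 1 ≤ numLevels C ε) (hε : 0 < ε)
    (hε2 : ε < 1 / 2) (hδ : 0 < δ) (hδ2 : δ < 1 / 2) :
    0 < logFactor C ε δ n w ∧
      20 * (numLevels C ε : ℝ) ^ 2 * (numCenters C ε n w + 1) *
        Real.exp (-((logFactor C ε δ n w : ℝ) / 32)) ≤ ε * δ := by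
  have hJ1 : (1 : ℝ) ≤ numLevels C ε := by exact_mod_cast hJ
  have hM0 : (0 : ℝ) ≤ numCenters C ε n w := Nat.cast_nonneg _
  have hceil := Nat.le_ceil
    (32 * Real.log (20 * (numLevels C ε : ℝ) ^ 2 * (numCenters C ε n w + 1) / (ε * δ)))
  change _ ≤ ((logFactor C ε δ n w : ℕ) : ℝ) at hceil
  have harg : 1 < 20 * (numLevels C ε : ℝ) ^ 2 * (numCenters C ε n w + 1) / (ε * δ) := by
    rw [lt_div_iff₀ (by positivity)]
    have h1 : ε * δ < 1 := by nlinarith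
    have h2 : (1 : ℝ) ≤ (numLevels C ε : ℝ) ^ 2 := one_le_pow₀ hJ1
    nlinarith
  refine ⟨Nat.ceil_pos.2 (mul_pos (by norm_num) (Real.log_pos harg)), ?_⟩
  set Q := 20 * (numLevels C ε : ℝ) ^ 2 * (numCenters C ε n w + 1) with hQ
  have h1 : Real.log (Q / (ε * δ)) ≤ (logFactor C ε δ n w : ℝ) / 32 := by
    rw [le_div_iff₀ (by norm_num)]
    linarith
  rw [Real.log_le_iff_le_exp (by linarith), div_le_iff₀ (by positivity)] at h1
  rw [Real.exp_neg, ← div_eq_mul_inv, div_le_iff₀ (Real.exp_pos _)]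
  linarith

theorem four_pow_eq (j : ℕ) : (4 : ℝ) ^ j = ((2 : ℝ) ^ j) ^ (2 : ℝ) := by
  rw [Real.rpow_two, ← pow_mul, mul_comm, pow_mul]; norm_num

theorem measure_margin_final_le {d : ℕ} {𝒳 : Set (Inst d)} {P : Measure (Inst d × Bool)}
    {η : Inst d → ℝ} {α L β C ε : ℝ} (hP : SmoothNoiseClass 𝒳 α L β C P η) (hC : 1 < C)
    (hβ : 0 < β) (hε : 0 < ε) {s : ℕ} (hs : 4 * (4 * C / ε) ^ (1 / (β + 1)) ≤ (2 : ℝ) ^ s) :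
    2 * (4 * (1 / 2 : ℝ) ^ s) * P.fst.real {z | |η z - 1 / 2| < 4 * (1 / 2 : ℝ) ^ s} ≤ ε / 2 := by
  have ht : (0 : ℝ) < 4 * (1 / 2) ^ s := by positivity
  have h1 := measure_margin_le hP hC.le hβ.le ht
  have hx : 0 < 4 * C / ε := by positivity
  have h2 : 4 * (1 / 2 : ℝ) ^ s ≤ ((4 * C / ε) ^ (1 / (β + 1)))⁻¹ := by
    have hpos : 0 < (4 * C / ε) ^ (1 / (β + 1)) := by positivity
    rw [one_div, inv_pow, ← div_eq_mul_inv, inv_eq_one_div, div_le_div_iff₀ (by positivity) hpos]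
    linarith
  have h3 : (4 * (1 / 2 : ℝ) ^ s) ^ (β + 1) ≤ ε / (4 * C) := by
    refine (Real.rpow_le_rpow ht.le h2 (by linarith)).trans (le_of_eq ?_)
    rw [Real.inv_rpow (by positivity), ← Real.rpow_mul hx.le,
      one_div_mul_cancel (by linarith), Real.rpow_one, inv_div]
  have h4 : (4 * (1 / 2 : ℝ) ^ s) * (4 * (1 / 2 : ℝ) ^ s) ^ β =
      (4 * (1 / 2 : ℝ) ^ s) ^ (β + 1) := by
    rw [Real.rpow_add_one ht.ne', mul_comm]
  calc _ ≤ 2 * (4 * (1 / 2 : ℝ) ^ s) * (C * (4 * (1 / 2 : ℝ) ^ s) ^ β) := by gcongr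
    _ = 2 * C * (4 * (1 / 2 : ℝ) ^ s) ^ (β + 1) := by rw [← h4]; ring
    _ ≤ 2 * C * (ε / (4 * C)) := by gcongr
    _ = ε / 2 := by field_simp; norm_num

theorem one_lt_scale {L γ : ℝ} (hL : 1 < L) (hγ : 0 < γ) (j : ℕ) :
    1 < (8 * L * (2 : ℝ) ^ j) ^ γ := by
  have := one_le_pow₀ (by norm_num : (1 : ℝ) ≤ 2) (n := j)
  exact Real.one_lt_rpow (by nlinarith) hγ

theorem scale_mono {L γ : ℝ} (hL : 1 < L) (hγ : 0 < γ) {j s : ℕ} (h : j ≤ s) :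
    (8 * L * (2 : ℝ) ^ j) ^ γ ≤ (8 * L * (2 : ℝ) ^ s) ^ γ :=
  Real.rpow_le_rpow (by positivity) (by gcongr; norm_num) hγ.le

/-- The size of the label block suffices for the label averages of the final level. -/
theorem le_size {L C β ε γ : ℝ} (hL : 1 < L) (hC : 1 < C) (hε : 0 < ε) (hβ : 0 < β) (hγ : 0 < γ)
    {J Λ w s : ℕ} (hJ : 1 ≤ J) (hΛ : 0 < Λ)
    (hs : (2 : ℝ) ^ s ≤ 8 * (4 * C / ε) ^ (1 / (β + 1)))
    (hw : 10 * (8 * L) ^ γ * (32 * C) ^ (2 + γ) * (J * Λ * (1 / ε) ^ ((2 + γ) / (β + 1))) ≤ w) :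
    4 * ((4 : ℝ) ^ s * Λ) * (8 * L * (2 : ℝ) ^ s) ^ γ ≤ (w / (J + 1) : ℕ) := by
  have hJ1 : (1 : ℝ) ≤ J := by exact_mod_cast hJ
  have hΛ1 : (1 : ℝ) ≤ Λ := by exact_mod_cast hΛ
  set Q := (8 * L * (2 : ℝ) ^ s) ^ γ with hQ
  have hQ1 : 1 < Q := one_lt_scale hL hγ s
  have hpow : (4 : ℝ) ^ s * Q ≤
      (8 * L) ^ γ * ((32 * C) ^ (2 + γ) * (1 / ε) ^ ((2 + γ) / (β + 1))) := by
    have := rpow_level_le hC hε hβ hs (e := 2 + γ) (by linarith) le_rfl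
    rw [hQ, Real.mul_rpow (by positivity) (by positivity), four_pow_eq, mul_left_comm,
      ← Real.rpow_add (by positivity)]
    exact mul_le_mul_of_nonneg_left this (by positivity)
  have hS1 : 1 ≤ (4 : ℝ) ^ s * Λ * Q :=
    one_le_mul_of_one_le_of_one_le (one_le_mul_of_one_le_of_one_le
      (one_le_pow₀ (by norm_num)) hΛ1) hQ1.le
  have hw' : 10 * J * ((4 : ℝ) ^ s * Λ * Q) ≤ w := by
    refine le_trans ?_ hw
    have := mul_le_mul_of_nonneg_left hpow (show (0 : ℝ) ≤ 10 * J * Λ by positivity)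
    calc _ = 10 * J * Λ * ((4 : ℝ) ^ s * Q) := by ring
      _ ≤ _ := this
      _ = _ := by ring
  have hdiv : (w : ℝ) < (J + 1) * ((w / (J + 1) : ℕ) + 1) := by
    have := Nat.lt_mul_div_succ w (show 0 < J + 1 by omega)
    exact_mod_cast this
  have h1 : ((J : ℝ) + 1) * (5 * ((4 : ℝ) ^ s * Λ * Q)) ≤ w := by
    refine le_trans ?_ hw'
    nlinarith
  have h2 := lt_of_mul_lt_mul_left (h1.trans_lt hdiv) (by positivity)
  linarith

/-- The expected number of net points of small margin, up to constants, in terms of the level. -/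
theorem count_le {L C β γ m t : ℝ} (hL : 1 < L) (hC : 1 < C) (hβ : 0 < β) (hβγ : β ≤ γ)
    {Λ j : ℕ} (hΛ : 0 < Λ) (hm : m ≤ C * (7 * (1 / 2 : ℝ) ^ j) ^ β) (ht0 : 0 ≤ t)
    (ht : t ≤ 2 * Λ * (8 * L * (2 : ℝ) ^ j) ^ γ) :
    2 * m * t + Λ + 1 ≤ 6 * C * Λ * ((56 * L) ^ γ * ((2 : ℝ) ^ j) ^ (γ - β)) := by
  have hΛ1 : (1 : ℝ) ≤ Λ := by exact_mod_cast hΛ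
  have hγ : 0 < γ := hβ.trans_le hβγ
  have hu1 : (1 : ℝ) ≤ 2 ^ j := one_le_pow₀ (by norm_num)
  have hpow : (7 * (1 / 2 : ℝ) ^ j) ^ β * (8 * L * (2 : ℝ) ^ j) ^ γ ≤
      (56 * L) ^ γ * ((2 : ℝ) ^ j) ^ (γ - β) := by
    have h7 : (7 : ℝ) ^ β ≤ 7 ^ γ := Real.rpow_le_rpow_of_exponent_le (by norm_num) hβγ
    rw [one_div, inv_pow, Real.mul_rpow (by norm_num) (by positivity),
      Real.inv_rpow (by positivity), Real.mul_rpow (by positivity) (by positivity),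
      Real.rpow_sub (by positivity), show 56 * L = 7 * (8 * L) by ring,
      Real.mul_rpow (x := 7) (by norm_num) (by positivity)]
    calc _ = (7 : ℝ) ^ β * ((8 * L) ^ γ * (((2 : ℝ) ^ j) ^ γ / ((2 : ℝ) ^ j) ^ β)) := by
          rw [div_eq_mul_inv]; ring
      _ ≤ 7 ^ γ * ((8 * L) ^ γ * (((2 : ℝ) ^ j) ^ γ / ((2 : ℝ) ^ j) ^ β)) :=
          mul_le_mul_of_nonneg_right h7 (by positivity)
      _ = _ := by ring
  have hone : 1 ≤ (56 * L) ^ γ * ((2 : ℝ) ^ j) ^ (γ - β) :=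
    one_le_mul_of_one_le_of_one_le (Real.one_le_rpow (by linarith) hγ.le)
      (Real.one_le_rpow hu1 (by linarith))
  generalize (56 * L) ^ γ * ((2 : ℝ) ^ j) ^ (γ - β) = Z at hpow hone ⊢
  have h1 : m * t ≤ C * (7 * (1 / 2 : ℝ) ^ j) ^ β * (2 * Λ * (8 * L * (2 : ℝ) ^ j) ^ γ) :=
    (mul_le_mul_of_nonneg_right hm ht0).trans (mul_le_mul_of_nonneg_left ht (by positivity))
  have h2 := mul_le_mul_of_nonneg_left hpow (show (0 : ℝ) ≤ 2 * C * Λ by positivity)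
  have h3 : (Λ : ℝ) ≤ C * Λ * Z := by
    have : 1 ≤ C * Z := one_le_mul_of_one_le_of_one_le hC.le hone
    calc (Λ : ℝ) = Λ * 1 := by ring
      _ ≤ Λ * (C * Z) := by gcongr
      _ = _ := by ring
  linarith

/-- The budget of a level suffices for the net points of small margin. -/
theorem le_budget {L C β ε γ x : ℝ} (hL : 1 < L) (hC : 1 < C) (hε : 0 < ε) (hβ : 0 < β)
    (hβγ : β ≤ γ) {J Λ n s j : ℕ} (hJ : 1 ≤ J) (hΛ : 0 < Λ) (hjs : j ≤ s)
    (hs : (2 : ℝ) ^ s ≤ 8 * (4 * C / ε) ^ (1 / (β + 1)))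
    (hx : x + 1 ≤ 6 * C * Λ * ((56 * L) ^ γ * ((2 : ℝ) ^ j) ^ (γ - β)))
    (hn : 6 * C * (56 * L) ^ γ * (32 * C) ^ (2 + γ) * (J * (Λ : ℝ) ^ 2 *
      (1 / ε) ^ ((2 + γ - β) / (β + 1))) ≤ n) :
    x ≤ (n / (J * (4 ^ j * Λ)) : ℕ) := by
  have hγ : 0 < γ := hβ.trans_le hβγ
  have hk : (0 : ℝ) < J * (4 ^ j * Λ) := by
    have : (1 : ℝ) ≤ J := by exact_mod_cast hJ
    have : (1 : ℝ) ≤ Λ := by exact_mod_cast hΛ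
    positivity
  have hdiv : (n : ℝ) < (J * (4 ^ j * Λ)) * ((n / (J * (4 ^ j * Λ)) : ℕ) + 1) := by
    have := Nat.lt_mul_div_succ n (show 0 < J * (4 ^ j * Λ) by positivity)
    exact_mod_cast this
  have hlev : (4 : ℝ) ^ j * ((56 * L) ^ γ * ((2 : ℝ) ^ j) ^ (γ - β)) ≤
      (56 * L) ^ γ * ((32 * C) ^ (2 + γ) * (1 / ε) ^ ((2 + γ - β) / (β + 1))) := by
    have h5 : ((2 : ℝ) ^ j) ^ (2 + γ - β) ≤ ((2 : ℝ) ^ s) ^ (2 + γ - β) :=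
      Real.rpow_le_rpow (by positivity) (pow_le_pow_right₀ (by norm_num) hjs) (by linarith)
    have := rpow_level_le hC hε hβ hs (e := 2 + γ - β) (E := 2 + γ) (by linarith) (by linarith)
    rw [four_pow_eq, mul_left_comm, ← Real.rpow_add (by positivity),
      show 2 + (γ - β) = 2 + γ - β by ring]
    exact mul_le_mul_of_nonneg_left (h5.trans this) (by positivity)
  generalize (56 * L) ^ γ * ((2 : ℝ) ^ j) ^ (γ - β) = Z at hx hlev
  have hn' : (J * (4 ^ j * Λ)) * (6 * C * Λ * Z) ≤ n := by
    refine le_trans ?_ hn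
    have := mul_le_mul_of_nonneg_left hlev (show (0 : ℝ) ≤ 6 * C * (J * (Λ : ℝ) ^ 2) by positivity)
    calc _ = 6 * C * (J * (Λ : ℝ) ^ 2) * (4 ^ j * Z) := by ring
      _ ≤ _ := this
      _ = _ := by ring
  have h6 := lt_of_mul_lt_mul_left (hn'.trans_lt hdiv) hk.le
  linarith

/-- The nets of the levels up to the final one fit into the candidate centers. -/
theorem net_le_numCenters {L γ : ℝ} (hL : 1 < L) (hγ : 1 ≤ γ) {v J s : ℕ} (hJ : 1 ≤ J)
    (hsJ : s ≤ J) (hv : (32 * L) ^ γ ≤ v) : 2 * (8 * L * (2 : ℝ) ^ s) ^ γ ≤ (v : ℝ) ^ J := by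
  have h2 : (2 : ℝ) ≤ 2 ^ γ := by
    simpa using Real.rpow_le_rpow_of_exponent_le (by norm_num : (1 : ℝ) ≤ 2) hγ
  have h3 : 16 * L * (2 : ℝ) ^ s ≤ (32 * L) ^ J := by
    have h4 : (2 : ℝ) ^ s ≤ 2 ^ J := pow_le_pow_right₀ (by norm_num) hsJ
    have h5 : 16 * L ≤ (16 * L) ^ J := le_self_pow₀ (by linarith) (by omega)
    calc 16 * L * (2 : ℝ) ^ s ≤ (16 * L) ^ J * 2 ^ J := by gcongr
      _ = (32 * L) ^ J := by rw [← mul_pow]; ring_nf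
  calc 2 * (8 * L * (2 : ℝ) ^ s) ^ γ ≤ 2 ^ γ * (8 * L * (2 : ℝ) ^ s) ^ γ := by gcongr
    _ = (16 * L * (2 : ℝ) ^ s) ^ γ := by
      rw [← Real.mul_rpow (by norm_num) (by positivity)]; ring_nf
    _ ≤ ((32 * L) ^ J) ^ γ := Real.rpow_le_rpow (by positivity) h3 (by linarith)
    _ = ((32 * L) ^ γ) ^ J := by
      rw [← Real.rpow_natCast, ← Real.rpow_natCast, ← Real.rpow_mul (by positivity),
        ← Real.rpow_mul (by positivity), mul_comm (J : ℝ) γ]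
    _ ≤ _ := pow_le_pow_left₀ (by positivity) hv _

/-- The learner achieves the accuracy `ε` if `n` and `w` exceed the label complexity and the pool
size up to constants and the logarithmic factors `numLevels` and `logFactor`. -/
theorem excessRiskBound_schedule {d : ℕ} (hd : 1 ≤ d) {L C α β ε δ : ℝ} (hL : 1 < L) (hC : 1 < C)
    (hα : 0 < α) (hα1 : α < 1) (hε : 0 < ε) (hε2 : ε < 1 / 2) (hδ : 0 < δ) (hδ2 : δ < 1 / 2)
    (hβ : 0 < β) {γ : ℝ} (hγ : γ = d / α) (hβγ : β ≤ γ) {n w : ℕ}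
    (hn : 6 * C * (56 * L) ^ γ * (32 * C) ^ (2 + γ) * (numLevels C ε *
      (logFactor C ε δ n w : ℝ) ^ 2 * (1 / ε) ^ ((2 + γ - β) / (β + 1))) ≤ n)
    (hw : 10 * (8 * L) ^ γ * (32 * C) ^ (2 + γ) * (numLevels C ε * logFactor C ε δ n w *
      (1 / ε) ^ ((2 + γ) / (β + 1))) ≤ w)
    (hv : (32 * L) ^ γ ≤ (min n w : ℕ))
    {𝒳 : Set (Inst d)} {P : Measure (Inst d × Bool)} {η : Inst d → ℝ}
    (hP : SmoothNoiseClass 𝒳 α L β C P η) :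
    ExcessRiskBound ((schedule C ε δ n w).learner d) P η ε δ := by
  obtain ⟨s, hs1, hsJ, hslo, hsup⟩ := exists_finalLevel hC hε hε2 hβ
  have hJ := hs1.trans hsJ
  obtain ⟨hΛpos, hprob⟩ := logFactor_spec (n := n) (w := w) hJ hε hε2 hδ hδ2
  set p := schedule C ε δ n w with hp
  set Λ := logFactor C ε δ n w with hΛ
  have hpΛ : p.Λ = Λ := rfl
  have hd1 : (1 : ℝ) ≤ d := by exact_mod_cast hd
  have hγ1 : 1 ≤ γ := by rw [hγ, le_div_iff₀ hα]; linarith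
  have hγ0 : 0 < γ := by linarith
  have hΛ1 : (1 : ℝ) ≤ Λ := by exact_mod_cast hΛpos
  have hQ1 := one_lt_scale (γ := γ) hL hγ0
  -- the masses of the neighbourhoods
  set q : ℕ → ℝ := fun j => ((8 * L * (2 : ℝ) ^ j) ^ γ)⁻¹ with hq
  have hqL : ∀ j, L * q j ^ (α / (d : ℝ)) ≤ (1 / 2 : ℝ) ^ j / 8 := by
    intro j
    have hb : 0 < 8 * L * (2 : ℝ) ^ j := by positivity
    have h1 : q j ^ (α / (d : ℝ)) = (8 * L * (2 : ℝ) ^ j)⁻¹ := by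
      simp only [hq]
      rw [Real.inv_rpow (Real.rpow_nonneg hb.le _), ← Real.rpow_mul hb.le,
        show γ * (α / d) = 1 by rw [hγ]; field_simp, Real.rpow_one]
    rw [h1, one_div, inv_pow]
    apply le_of_eq
    field_simp
  -- the sizes of the nets
  set T : ℕ → ℕ := fun j => ⌈Λ * (8 * L * (2 : ℝ) ^ j) ^ γ⌉₊ with hT
  have hTup : ∀ j, (T j : ℝ) ≤ 2 * Λ * (8 * L * (2 : ℝ) ^ j) ^ γ := by
    intro j
    have h2 : 1 ≤ Λ * (8 * L * (2 : ℝ) ^ j) ^ γ :=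
      one_le_mul_of_one_le_of_one_le hΛ1 (hQ1 j).le
    have h1 := (Nat.ceil_lt_add_one (a := Λ * (8 * L * (2 : ℝ) ^ j) ^ γ) (by linarith)).le
    simp only [hT]
    linarith
  have hsize : 4 * ((4 : ℝ) ^ s * Λ) * (8 * L * (2 : ℝ) ^ s) ^ γ ≤ p.size :=
    le_size hL hC hε hβ hγ0 hJ hΛpos hsup hw
  have h4s : (1 : ℝ) ≤ 4 ^ s := one_le_pow₀ (by norm_num)
  have h4Λ : 4 * (Λ : ℝ) ≤ 4 * ((4 : ℝ) ^ s * Λ) := by nlinarith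
  have hTsize : ∀ j, j ≤ s → T j ≤ p.size := by
    intro j hj
    have : (T j : ℝ) ≤ p.size := (hTup j).trans (le_trans (mul_le_mul (by linarith)
      (scale_mono hL hγ0 hj) (by linarith [hQ1 j]) (by positivity)) hsize)
    exact_mod_cast this
  have hbudget : ∀ j, 1 ≤ j → j ≤ s →
      2 * P.fst.real {z | |η z - 1 / 2| < 7 * (1 / 2 : ℝ) ^ j} * T j + p.Λ ≤ p.budget j := by
    intro j hj1 hjs
    have hmarg := measure_margin_le hP hC.le hβ.le (show (0 : ℝ) < 7 * (1 / 2) ^ j by positivity)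
    exact le_budget hL hC hε hβ hβγ hJ hΛpos hjs hsup
      (count_le hL hC hβ hβγ hΛpos hmarg (Nat.cast_nonneg _) (hTup j)) hn
  have hTM : ∀ j, 1 ≤ j → j ≤ s → T j ≤ p.M := by
    intro j hj1 hjs
    have hΛv : (Λ : ℝ) ≤ (min n w : ℕ) := by
      rw [Nat.cast_min]
      refine le_min ?_ ?_
      · have h1 := hbudget 1 le_rfl hs1
        have h3 : (p.budget 1 : ℝ) ≤ n := by exact_mod_cast Nat.div_le_self _ _
        have h4 : (0 : ℝ) ≤ 2 * P.fst.real {z | |η z - 1 / 2| < 7 * (1 / 2 : ℝ) ^ 1} * T 1 := by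
          positivity
        rw [hpΛ] at h1
        linarith
      · have h3 : (p.size : ℝ) ≤ w := by exact_mod_cast Nat.div_le_self _ _
        refine le_trans ?_ (hsize.trans h3)
        calc (Λ : ℝ) ≤ 4 * ((4 : ℝ) ^ s * Λ) * 1 := by linarith
          _ ≤ _ := mul_le_mul_of_nonneg_left (hQ1 s).le (by positivity)
    have h2 : (T j : ℝ) ≤ (p.M : ℕ) := by
      have hMdef : p.M = min n w ^ numLevels C ε * min n w := pow_succ _ _
      rw [hMdef, Nat.cast_mul, Nat.cast_pow]
      refine (hTup j).trans ?_
      calc 2 * Λ * (8 * L * (2 : ℝ) ^ j) ^ γ ≤ 2 * Λ * (8 * L * (2 : ℝ) ^ s) ^ γ :=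
            mul_le_mul_of_nonneg_left (scale_mono hL hγ0 hjs) (by positivity)
        _ = 2 * (8 * L * (2 : ℝ) ^ s) ^ γ * Λ := by ring
        _ ≤ _ := mul_le_mul (net_le_numCenters hL hγ1 hJ hsJ hv) hΛv (Nat.cast_nonneg _)
          (by positivity)
    exact_mod_cast h2
  refine p.excessRiskBound_learner hP (by linarith) hα.le hs1 hsJ hΛpos (q := q) (T := T)
    (fun j _ _ => inv_pos.2 (by linarith [hQ1 j]))
    (fun j _ _ => inv_lt_one_of_one_lt₀ (hQ1 j)) (fun j _ _ => hqL j)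
    hTM (fun j _ hjs => hTsize j hjs) (fun j _ _ => ?_) ?_ hbudget hε (by linarith) hprob
    (measure_margin_final_le hP hC hβ hε hslo)
  · have h1 := Nat.le_ceil (Λ * (8 * L * (2 : ℝ) ^ j) ^ γ)
    rw [inv_mul_eq_div, le_div_iff₀ (by linarith [hQ1 j])]
    exact h1
  · have : p.labels s = 4 ^ s * Λ := rfl
    rw [inv_mul_eq_div, le_div_iff₀ (by linarith [hQ1 s]), this]
    push_cast
    exact hsize

end Parameters

/-! ### Growth of the parameters -/

section Growth

/-- Numerical bounds that follow from `log 2 ≤ log (1 / ε)` and `log 2 ≤ log (1 / δ)`; they allow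
to absorb constants and each of the two logarithms into their product. -/
theorem log_inv_bounds {ε δ : ℝ} (hε : 0 < ε) (hε2 : ε < 1 / 2) (hδ : 0 < δ) (hδ2 : δ < 1 / 2) :
    0.69 ≤ Real.log (1 / ε) ∧ 0.69 ≤ Real.log (1 / δ) ∧
      0.476 ≤ Real.log (1 / ε) * Real.log (1 / δ) ∧
      Real.log (1 / ε) ≤ 1.5 * (Real.log (1 / ε) * Real.log (1 / δ)) ∧
      Real.log (1 / δ) ≤ 1.5 * (Real.log (1 / ε) * Real.log (1 / δ)) := by
  have key : ∀ x : ℝ, 0 < x → x < 1 / 2 → 0.69 ≤ Real.log (1 / x) := by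
    intro x hx hx2
    have h1 : Real.log 2 ≤ Real.log (1 / x) :=
      Real.log_le_log (by norm_num) (by rw [le_div_iff₀ hx]; linarith)
    linarith [Real.log_two_gt_d9]
  have ha := key ε hε hε2
  have hb := key δ hδ hδ2
  refine ⟨ha, hb, by nlinarith, by nlinarith, by nlinarith⟩

theorem numLevels_pos {C ε : ℝ} (hC : 1 < C) (hε : 0 < ε) (hε2 : ε < 1 / 2) :
    1 ≤ numLevels C ε :=
  Nat.ceil_pos.2 (Real.logb_pos (by norm_num) (by rw [lt_div_iff₀ hε]; linarith))

theorem numLevels_le {C ε δ : ℝ} (hC : 1 < C) (hε : 0 < ε) (hε2 : ε < 1 / 2) (hδ : 0 < δ)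
    (hδ2 : δ < 1 / 2) : (numLevels C ε : ℝ) ≤
      (4 * Real.log (16 * C) + 5) * (Real.log (1 / ε) * Real.log (1 / δ)) := by
  obtain ⟨ha, hb, hl, hal, -⟩ := log_inv_bounds hε hε2 hδ hδ2
  set a := Real.log (1 / ε)
  set l := a * Real.log (1 / δ)
  have hlogC : 0 < Real.log (16 * C) := Real.log_pos (by linarith)
  have h1 : Real.logb 2 (16 * C / ε) = (Real.log (16 * C) + a) / Real.log 2 := by
    rw [Real.logb, ← Real.log_mul (by positivity) (by positivity)]
    ring_nf
  have h2 : Real.logb 2 (16 * C / ε) ≤ 1.5 * (Real.log (16 * C) + a) := by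
    rw [h1, div_le_iff₀ (by linarith [Real.log_two_gt_d9])]
    nlinarith [Real.log_two_gt_d9]
  have h3 : 0 ≤ Real.logb 2 (16 * C / ε) := by rw [h1]; positivity
  have h4 : (numLevels C ε : ℝ) < _ := Nat.ceil_lt_add_one h3
  nlinarith

theorem logFactor_le {C ε δ : ℝ} (hC : 1 < C) (hε : 0 < ε) (hε2 : ε < 1 / 2) (hδ : 0 < δ)
    (hδ2 : δ < 1 / 2) {n w : ℕ} (hv : 3 ≤ min n w) : (logFactor C ε δ n w : ℝ) ≤
      (1000 + 100 * (4 * Real.log (16 * C) + 5)) *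
        (Real.log (1 / ε) * Real.log (1 / δ) * Real.log (min n w : ℕ)) := by
  have hJ := numLevels_le hC hε hε2 hδ hδ2
  have hJ1 : (1 : ℝ) ≤ numLevels C ε := by exact_mod_cast numLevels_pos hC hε hε2
  obtain ⟨ha, hb, hl, hal, hbl⟩ := log_inv_bounds hε hε2 hδ hδ2
  have hlv : 1 ≤ Real.log (min n w : ℕ) := by
    rw [Real.le_log_iff_exp_le (by exact_mod_cast (by omega : 0 < min n w))]
    have : (3 : ℝ) ≤ (min n w : ℕ) := by exact_mod_cast hv
    linarith [Real.exp_one_lt_d9]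
  have hMle : (numCenters C ε n w : ℝ) + 1 ≤ 2 * (min n w : ℕ) ^ (numLevels C ε + 1) := by
    have : (1 : ℝ) ≤ ((min n w : ℕ) : ℝ) ^ (numLevels C ε + 1) :=
      one_le_pow₀ (by exact_mod_cast (by omega : 1 ≤ min n w))
    simp only [numCenters, Nat.cast_pow]
    linarith
  have hvpos : (0 : ℝ) < (min n w : ℕ) := by exact_mod_cast (by omega : 0 < min n w)
  set a := Real.log (1 / ε) with hadef
  set b := Real.log (1 / δ) with hbdef
  set v : ℝ := ((min n w : ℕ) : ℝ)
  have hM : Real.log (numCenters C ε n w + 1) ≤ 0.7 + (numLevels C ε + 1) * Real.log v := by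
    refine (Real.log_le_log (by positivity) hMle).trans ?_
    rw [Real.log_mul (by norm_num) (by positivity), Real.log_pow]
    push_cast
    linarith [Real.log_two_lt_d9]
  have hJlog : Real.log (numLevels C ε) ≤ numLevels C ε := Real.log_le_self (by linarith)
  have h20 : Real.log 20 ≤ 3.5 := by
    have h : Real.log 20 ≤ Real.log (2 ^ 5) := Real.log_le_log (by norm_num) (by norm_num)
    rw [Real.log_pow] at h
    push_cast at h
    linarith [Real.log_two_lt_d9]
  have hexp : Real.log (20 * (numLevels C ε : ℝ) ^ 2 * (numCenters C ε n w + 1) / (ε * δ)) =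
      Real.log 20 + 2 * Real.log (numLevels C ε) + Real.log (numCenters C ε n w + 1) + a + b := by
    rw [Real.log_div (by positivity) (by positivity), Real.log_mul (by positivity) (by positivity),
      Real.log_mul (by positivity) (by positivity), Real.log_pow, Real.log_mul hε.ne' hδ.ne',
      hadef, hbdef, one_div, one_div, Real.log_inv, Real.log_inv]
    push_cast
    ring
  have hM0 : 0 ≤ Real.log ((numCenters C ε n w : ℝ) + 1) :=
    Real.log_nonneg (by linarith [(Nat.cast_nonneg (numCenters C ε n w) : (0 : ℝ) ≤ _)])
  have h0 : 0 ≤ 32 *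
      Real.log (20 * (numLevels C ε : ℝ) ^ 2 * (numCenters C ε n w + 1) / (ε * δ)) := by
    rw [hexp]
    have := Real.log_nonneg hJ1
    have := Real.log_nonneg (by norm_num : (1 : ℝ) ≤ 20)
    linarith
  have h1 : (logFactor C ε δ n w : ℝ) < _ := Nat.ceil_lt_add_one h0
  rw [hexp] at h1
  refine h1.le.trans ?_
  have hlogC : 0 < Real.log (16 * C) := Real.log_pos (by linarith)
  set c := 4 * Real.log (16 * C) + 5 with hc
  have hJ' : (numLevels C ε : ℝ) * Real.log v ≤ c * (a * b * Real.log v) := by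
    nlinarith
  have hJ'' : (numLevels C ε : ℝ) ≤ numLevels C ε * Real.log v := le_mul_of_one_le_right
    (by linarith) hlv
  have ht : a * b ≤ a * b * Real.log v := le_mul_of_one_le_right (by linarith) hlv
  have ht2 : Real.log v ≤ 2.2 * (a * b * Real.log v) := by nlinarith
  nlinarith

/-- Up to a constant, `y / (log y) ^ 2` exceeds `l ^ 3 * X` once `y` exceeds `l ^ 5 * X`, if `X` is
at most exponential in `l`. This turns the requirements of `excessRiskBound_schedule`, where
`logFactor` depends on `n` and `w`, into explicit ones. -/
theorem exists_growth_constant {A B : ℝ} (hA : 0 < A) (hB : 0 ≤ B) (y₀ : ℝ) :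
    ∃ K : ℝ, 0 < K ∧ ∀ l a X y : ℝ, 0.476 ≤ l → a ≤ 2 * l → 1 ≤ X →
      X ≤ Real.exp (B * a) → K * l ^ 5 * X ≤ y →
      A * (l ^ 3 * Real.log y ^ 2 * X) ≤ y ∧ y₀ ≤ y := by
  -- `K` is taken so large that `K` exceeds `c * (log K) ^ 2`, and `K * l ^ 5`, which is at least
  -- `K / 50`, exceeds `y₀` and `exp 2`, from where on `log y / √y` is decreasing.
  set c := A * (8 + 2 * B) ^ 2 with hc
  have hc0 : 0 < c := by positivity
  have h1 : ∀ᶠ K : ℝ in Filter.atTop, ‖Real.log K ^ 2‖ ≤ c⁻¹ * ‖id K‖ :=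
    (Real.isLittleO_pow_log_id_atTop (n := 2)).def (inv_pos.2 hc0)
  obtain ⟨K, hK1, hK2⟩ := (h1.and (Filter.eventually_ge_atTop
    (max (Real.exp 1) (50 * max (Real.exp 2) y₀)))).exists
  have hKe : Real.exp 1 ≤ K := (le_max_left _ _).trans hK2
  have hKy : 50 * max (Real.exp 2) y₀ ≤ K := (le_max_right _ _).trans hK2
  have hK0 : 0 < K := (Real.exp_pos 1).trans_le hKe
  have hlogK : 1 ≤ Real.log K := (Real.le_log_iff_exp_le hK0).2 hKe
  have hK : c * Real.log K ^ 2 ≤ K := by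
    rw [Real.norm_of_nonneg (by positivity), id, Real.norm_of_nonneg hK0.le, inv_mul_eq_div,
      le_div_iff₀ hc0] at hK1
    linarith
  refine ⟨K, hK0, fun l a X y hl hal hX hXB hy => ?_⟩
  have hl0 : 0 < l := by linarith
  have hX0 : 0 < X := by linarith
  set Y := K * l ^ 5 * X with hY
  have hYlow : max (Real.exp 2) y₀ ≤ Y := by
    have h2 : (0.476 : ℝ) ^ 5 ≤ l ^ 5 := pow_le_pow_left₀ (by norm_num) hl 5
    have h3 : (1 : ℝ) / 50 ≤ l ^ 5 * X := by
      have : (0.476 : ℝ) ^ 5 ≥ 1 / 50 := by norm_num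
      nlinarith
    have h4 : K * (1 / 50) ≤ K * (l ^ 5 * X) := by gcongr
    rw [hY, mul_assoc]
    linarith
  have hYe : Real.exp 2 ≤ Y := (le_max_left _ _).trans hYlow
  have hY0 : 0 < Y := (Real.exp_pos 2).trans_le hYe
  have hy0 : 0 < y := hY0.trans_le hy
  refine ⟨?_, (le_max_right _ _).trans (hYlow.trans hy)⟩
  have hlogX : Real.log X ≤ 2 * B * l := by
    have h2 := Real.log_le_log hX0 hXB
    rw [Real.log_exp] at h2
    nlinarith
  have hlogY : Real.log Y ≤ (8 + 2 * B) * Real.log K * l := by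
    rw [hY, Real.log_mul (by positivity) hX0.ne', Real.log_mul hK0.ne' (by positivity),
      Real.log_pow]
    have h2 := Real.log_le_self hl0.le
    have h3 : Real.log K ≤ 2.2 * (Real.log K * l) := by nlinarith
    have h4 : l ≤ Real.log K * l := le_mul_of_one_le_left hl0.le hlogK
    have h5 : B * l ≤ B * (Real.log K * l) := by gcongr
    push_cast
    nlinarith
  have hlogY0 : 0 ≤ Real.log Y := Real.log_nonneg (by linarith [Real.one_le_exp zero_le_two])
  have hlogy0 : 0 ≤ Real.log y :=
    Real.log_nonneg (by linarith [Real.one_le_exp zero_le_two])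
  have hanti : Real.log y / √y ≤ Real.log Y / √Y :=
    Real.log_div_sqrt_antitoneOn hYe (hYe.trans hy) hy
  have hsq : Real.log y ^ 2 * Y ≤ Real.log Y ^ 2 * y := by
    have h2 := pow_le_pow_left₀ (by positivity) hanti 2
    rwa [div_pow, div_pow, Real.sq_sqrt hy0.le, Real.sq_sqrt hY0.le, div_le_div_iff₀ hy0 hY0] at h2
  have hlogY2 : A * Real.log Y ^ 2 ≤ K * l ^ 2 := by
    calc A * Real.log Y ^ 2 ≤ A * ((8 + 2 * B) * Real.log K * l) ^ 2 := by gcongr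
      _ = c * Real.log K ^ 2 * l ^ 2 := by rw [hc]; ring
      _ ≤ _ := by gcongr
  refine le_of_mul_le_mul_left ?_ (by positivity : 0 < K * l ^ 2)
  calc K * l ^ 2 * (A * (l ^ 3 * Real.log y ^ 2 * X)) = A * (Real.log y ^ 2 * Y) := by
        rw [hY]; ring
    _ ≤ A * (Real.log Y ^ 2 * y) := by gcongr
    _ = A * Real.log Y ^ 2 * y := by ring
    _ ≤ _ := by gcongr

theorem inv_rpow_bounds {ε e B : ℝ} (hε : 0 < ε) (hε1 : ε < 1) (he : 0 ≤ e) (heB : e ≤ B) :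
    1 ≤ (1 / ε) ^ e ∧ (1 / ε) ^ e ≤ Real.exp (B * Real.log (1 / ε)) := by
  have h1 : 1 < 1 / ε := by rw [lt_div_iff₀ hε]; linarith
  refine ⟨Real.one_le_rpow h1.le he, ?_⟩
  rw [Real.rpow_def_of_pos (by positivity), mul_comm]
  exact Real.exp_le_exp.2 (mul_le_mul_of_nonneg_right heB (Real.log_pos h1).le)

/-- The label complexity and the pool size of the learner. -/
theorem exists_sampleComplexity {d : ℕ} (hd : 1 ≤ d) {L C α : ℝ} (hL : 1 < L) (hC : 1 < C)
    (hα : 0 < α) (hα1 : α < 1) : ∃ K : ℝ, 0 < K ∧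
      ∀ ε δ β : ℝ, 0 < ε → ε < 1 / 2 → 0 < δ → δ < 1 / 2 → 0 < β → α * β ≤ d →
        ∀ n w : ℕ,
          K * (Real.log (1 / ε) * Real.log (1 / δ)) ^ 5 *
            (1 / ε) ^ ((2 * α + d - α * β) / (α * (β + 1))) ≤ n →
          K * (Real.log (1 / ε) * Real.log (1 / δ)) ^ 5 *
            (1 / ε) ^ ((2 * α + d) / (α * (β + 1))) ≤ w →
          ∀ (𝒳 : Set (Inst d)) (P : Measure (Inst d × Bool)) (η : Inst d → ℝ),
            SmoothNoiseClass 𝒳 α L β C P η →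
              ExcessRiskBound ((schedule C ε δ n w).learner d) P η ε δ := by
  obtain ⟨γ, hγ⟩ : ∃ γ : ℝ, γ = d / α := ⟨_, rfl⟩
  have hγ0 : 0 < γ := by
    have : (0 : ℝ) < d := by exact_mod_cast hd
    rw [hγ]; positivity
  have hlogC : 0 < Real.log (16 * C) := Real.log_pos (by linarith)
  set cJ := 4 * Real.log (16 * C) + 5 with hcJ
  have hcJ0 : 0 < cJ := by positivity
  set cΛ := 1000 + 100 * cJ with hcΛ
  have hcΛ0 : 0 < cΛ := by positivity
  set A₁ := 6 * C * (56 * L) ^ γ * (32 * C) ^ (2 + γ) with hA₁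
  set A₂ := 10 * (8 * L) ^ γ * (32 * C) ^ (2 + γ) with hA₂
  have hA₁0 : 0 < A₁ := by positivity
  have hA₂0 : 0 < A₂ := by positivity
  obtain ⟨K₁, hK₁, h₁⟩ := exists_growth_constant (A := A₁ * (cJ * cΛ ^ 2)) (B := 2 + γ)
    (by positivity) (by positivity) (max ((32 * L) ^ γ) 3)
  obtain ⟨K₂, hK₂, h₂⟩ := exists_growth_constant (A := A₂ * (cJ * cΛ * 3)) (B := 2 + γ)
    (by positivity) (by positivity) (max ((32 * L) ^ γ) 3)
  refine ⟨max K₁ K₂, lt_max_of_lt_left hK₁, ?_⟩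
  intro ε δ β hε hε2 hδ hδ2 hβ hαβ n w hn hw 𝒳 P η hP
  have hβγ : β ≤ γ := by rw [hγ, le_div_iff₀ hα]; linarith
  have hdα : (d : ℝ) = γ * α := by rw [hγ]; field_simp
  have he₁ : (2 * α + d - α * β) / (α * (β + 1)) = (2 + γ - β) / (β + 1) := by
    rw [hdα]; field_simp
  have he₂ : (2 * α + d) / (α * (β + 1)) = (2 + γ) / (β + 1) := by
    rw [hdα]; field_simp
  rw [he₁] at hn
  rw [he₂] at hw
  have hX₁ := inv_rpow_bounds (e := (2 + γ - β) / (β + 1)) (B := 2 + γ) hε (by linarith)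
    (div_nonneg (by linarith) (by linarith)) ((div_le_iff₀ (by linarith)).2 (by nlinarith))
  have hX₂ := inv_rpow_bounds (e := (2 + γ) / (β + 1)) (B := 2 + γ) hε (by linarith)
    (div_nonneg (by linarith) (by linarith)) ((div_le_iff₀ (by linarith)).2 (by nlinarith))
  have hJ := numLevels_le hC hε hε2 hδ hδ2
  have hΛ := @logFactor_le C ε δ hC hε hε2 hδ hδ2 n w
  obtain ⟨ha, hb, hl, hal, -⟩ := log_inv_bounds hε hε2 hδ hδ2
  set a := Real.log (1 / ε)
  set l := a * Real.log (1 / δ)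
  have hl0 : 0 < l := by linarith
  set X₁ := (1 / ε) ^ ((2 + γ - β) / (β + 1))
  set X₂ := (1 / ε) ^ ((2 + γ) / (β + 1))
  have hX₁0 : 0 < X₁ := by linarith [hX₁.1]
  have hX₂0 : 0 < X₂ := by linarith [hX₂.1]
  have hn1 : K₁ * l ^ 5 * X₁ ≤ n := le_trans (by gcongr; exact le_max_left _ _) hn
  have hw1 : K₂ * l ^ 5 * X₂ ≤ w := le_trans (by gcongr; exact le_max_right _ _) hw
  obtain ⟨hn2, hn3⟩ := h₁ l a X₁ n hl (by linarith) hX₁.1 hX₁.2 hn1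
  obtain ⟨hw2, hw3⟩ := h₂ l a X₂ w hl (by linarith) hX₂.1 hX₂.2 hw1
  have hv : max ((32 * L) ^ γ) 3 ≤ ((min n w : ℕ) : ℝ) := by
    rw [Nat.cast_min]; exact le_min hn3 hw3
  have hv3 : 3 ≤ min n w := by exact_mod_cast (le_max_right _ _).trans hv
  have hvpos : (0 : ℝ) < (min n w : ℕ) := by exact_mod_cast (by omega : 0 < min n w)
  have hv1 : (1 : ℝ) ≤ (min n w : ℕ) := by exact_mod_cast (by omega : 1 ≤ min n w)
  have hlv0 : 0 ≤ Real.log (min n w : ℕ) := Real.log_nonneg hv1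
  have hlvn : Real.log (min n w : ℕ) ≤ Real.log n :=
    Real.log_le_log hvpos (by exact_mod_cast min_le_left _ _)
  have hlvw : Real.log (min n w : ℕ) ≤ Real.log w :=
    Real.log_le_log hvpos (by exact_mod_cast min_le_right _ _)
  have hlw1 : 1 ≤ Real.log w := by
    have h3 : (3 : ℝ) ≤ w := (le_max_right _ _).trans hw3
    rw [Real.le_log_iff_exp_le (by linarith)]
    linarith [Real.exp_one_lt_d9]
  have hΛn : (logFactor C ε δ n w : ℝ) ≤ cΛ * (l * Real.log n) :=
    (hΛ hv3).trans (by gcongr)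
  have hΛw : (logFactor C ε δ n w : ℝ) ≤ cΛ * (l * Real.log w) :=
    (hΛ hv3).trans (by gcongr)
  refine excessRiskBound_schedule hd hL hC hα hα1 hε hε2 hδ hδ2 hβ hγ hβγ ?_ ?_
    ((le_max_left _ _).trans hv) hP
  · calc A₁ * (numLevels C ε * (logFactor C ε δ n w : ℝ) ^ 2 * X₁)
        ≤ A₁ * ((cJ * l) * (cΛ * (l * Real.log n)) ^ 2 * X₁) := by gcongr
      _ = A₁ * (cJ * cΛ ^ 2) * (l ^ 3 * Real.log n ^ 2 * X₁) := by ring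
      _ ≤ n := hn2
  -- The bound on `w` would hold with one logarithm less; `exists_growth_constant` allows for two.
  · have h3 : 1 ≤ 3 * (l * Real.log w) := by
      linarith [le_mul_of_one_le_right hl0.le hlw1]
    calc A₂ * (numLevels C ε * (logFactor C ε δ n w : ℝ) * X₂)
        ≤ A₂ * ((cJ * l) * (cΛ * (l * Real.log w)) * X₂) := by gcongr
      _ = A₂ * (cJ * cΛ) * (l ^ 2 * Real.log w * X₂) * 1 := by ring
      _ ≤ A₂ * (cJ * cΛ) * (l ^ 2 * Real.log w * X₂) * (3 * (l * Real.log w)) := by gcongr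
      _ = A₂ * (cJ * cΛ * 3) * (l ^ 3 * Real.log w ^ 2 * X₂) := by ring
      _ ≤ w := hw2

/-- Solving `n = K₁ * (logarithms) * (1 / ε) ^ E` for the accuracy `ε`. -/
theorem exists_accuracy {K₁ E : ℝ} (hK₁ : 0 < K₁) (hE : 0 < E) :
    ∃ (K : ℝ) (m : ℕ), 0 < K ∧ ∀ δ : ℝ, 0 < δ → δ < 1 → ∃ N : ℕ, ∀ n : ℕ, N ≤ n →
      ∃ ε : ℝ, 0 < ε ∧ ε < 1 / 2 ∧
        K₁ * (Real.log (1 / ε) * Real.log (1 / δ)) ^ 5 * (1 / ε) ^ E ≤ n ∧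
        ε ≤ K * Real.log n ^ m * (n : ℝ) ^ (-(1 / E)) := by
  refine ⟨K₁ ^ (1 / E), ⌈10 / E⌉₊, by positivity, fun δ hδ hδ1 => ?_⟩
  have hb : 0 < Real.log (1 / δ) := Real.log_pos (by rw [lt_div_iff₀ hδ]; linarith)
  have hlog : Filter.Tendsto (fun n : ℕ => Real.log n) Filter.atTop Filter.atTop :=
    Real.tendsto_log_atTop.comp tendsto_natCast_atTop_atTop
  have hc : 0 < (1 / 2 : ℝ) ^ E / (2 * K₁) := by positivity
  have h1 : ∀ᶠ n : ℕ in Filter.atTop,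
      ‖Real.log n ^ 10‖ ≤ (1 / 2 : ℝ) ^ E / (2 * K₁) * ‖id (n : ℝ)‖ :=
    tendsto_natCast_atTop_atTop.eventually
      ((Real.isLittleO_pow_log_id_atTop (n := 10)).def hc)
  obtain ⟨N, hN⟩ := Filter.eventually_atTop.1 (h1.and ((hlog.eventually_ge_atTop
    (max (max 1 (1 / K₁)) (Real.log (1 / δ) / E))).and (Filter.eventually_ge_atTop 1)))
  refine ⟨N, fun n hn => ?_⟩
  obtain ⟨hlo, hge, hn1⟩ := hN n hn
  have hn0 : (0 : ℝ) < n := by exact_mod_cast hn1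
  have hl1 : 1 ≤ Real.log n := ((le_max_left _ _).trans (le_max_left _ _)).trans hge
  have hlK : 1 / K₁ ≤ Real.log n := ((le_max_right _ _).trans (le_max_left _ _)).trans hge
  have hlδ : Real.log (1 / δ) / E ≤ Real.log n := (le_max_right _ _).trans hge
  set l := Real.log n with hl
  have hl0 : 0 < l := by linarith
  rw [Real.norm_of_nonneg (by positivity), id, Real.norm_of_nonneg hn0.le] at hlo
  have hKl : 1 ≤ K₁ * l ^ 10 := by
    have h2 : l ≤ l ^ 10 := le_self_pow₀ hl1 (by norm_num)
    have h3 : K₁ * (1 / K₁) ≤ K₁ * l ^ 10 := by gcongr; linarith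
    rwa [mul_one_div_cancel hK₁.ne'] at h3
  -- With `ε = x ^ (1 / E)`, one factor `(log n) ^ 5` absorbs `log (1 / ε) ^ 5`, and the other one
  -- absorbs `log (1 / δ) ^ 5` for large `n`.
  set x := K₁ * l ^ 10 / n with hx
  have hx0 : 0 < x := by positivity
  have hEE : 1 / E * E = 1 := by field_simp
  have hεE : (x ^ (1 / E)) ^ E = x := by rw [← Real.rpow_mul hx0.le, hEE, Real.rpow_one]
  refine ⟨x ^ (1 / E), by positivity, ?_, ?_, ?_⟩
  · have hx2 : x < (1 / 2) ^ E := by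
      have hp : (0 : ℝ) < (1 / 2) ^ E := by positivity
      rw [hx, div_lt_iff₀ hn0]
      have h2 : K₁ * l ^ 10 ≤ K₁ * ((1 / 2 : ℝ) ^ E / (2 * K₁) * n) := by gcongr
      have h3 : K₁ * ((1 / 2 : ℝ) ^ E / (2 * K₁) * n) = (1 / 2 : ℝ) ^ E * n / 2 := by field_simp
      have h4 : 0 < (1 / 2 : ℝ) ^ E * n := by positivity
      linarith
    have h2 : x ^ (1 / E) < ((1 / 2 : ℝ) ^ E) ^ (1 / E) :=
      Real.rpow_lt_rpow hx0.le hx2 (by positivity)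
    rwa [← Real.rpow_mul (by norm_num), mul_comm E, hEE, Real.rpow_one] at h2
  · have hinv : (1 / x ^ (1 / E)) ^ E = x⁻¹ := by
      rw [one_div, Real.inv_rpow (by positivity), hεE]
    have hloginv : Real.log (1 / x ^ (1 / E)) ≤ l / E := by
      have h2 : Real.log x⁻¹ ≤ l := by
        refine Real.log_le_log (by positivity) ?_
        rw [hx, inv_div, div_le_iff₀ (by positivity)]
        exact le_mul_of_one_le_right hn0.le hKl
      rw [one_div, ← Real.inv_rpow hx0.le, Real.log_rpow (by positivity), one_div, inv_mul_eq_div]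
      gcongr
    have hpow : (Real.log (1 / x ^ (1 / E)) * Real.log (1 / δ)) ^ 5 ≤ l ^ 10 := by
      have h2 : Real.log (1 / x ^ (1 / E)) * Real.log (1 / δ) ≤ l ^ 2 := by
        calc _ ≤ l / E * Real.log (1 / δ) := by gcongr
          _ = l * (Real.log (1 / δ) / E) := by ring
          _ ≤ l * l := by gcongr
          _ = l ^ 2 := by ring
      calc _ ≤ (l ^ 2) ^ 5 := (Odd.strictMono_pow (by decide : Odd 5)).monotone h2
        _ = l ^ 10 := by ring
    rw [hinv]
    calc _ ≤ K₁ * l ^ 10 * x⁻¹ := by gcongr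
      _ = n := by rw [hx]; field_simp
  · have hlm : (l ^ 10) ^ (1 / E) ≤ l ^ ⌈10 / E⌉₊ := by
      rw [← Real.rpow_natCast, ← Real.rpow_natCast, ← Real.rpow_mul hl0.le]
      refine Real.rpow_le_rpow_of_exponent_le hl1 ?_
      have := Nat.le_ceil (10 / E)
      rw [mul_one_div]
      exact_mod_cast this
    rw [hx, Real.div_rpow (by positivity) hn0.le, Real.mul_rpow hK₁.le (by positivity),
      Real.rpow_neg hn0.le, ← div_eq_mul_inv]
    gcongr

theorem ExcessRiskBound.mono {d w : ℕ} {A : ActiveLearner d w} {P : Measure (Inst d × Bool)}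
    {η : Inst d → ℝ} {ε ε' δ : ℝ} (h : ExcessRiskBound A P η ε δ) (hε : ε ≤ ε') :
    ExcessRiskBound A P η ε' δ :=
  (measure_mono fun _ hD => lt_of_le_of_lt hε hD).trans h

end Growth

theorem theorem2 (d : ℕ) (hd : 1 ≤ d) (L C : ℝ) (hL : 1 < L) (hC : 1 < C) :
    -- the learner has the inputs `ε`, `δ`, `n`, `w` (besides `d`, `L`, `C`), but not `α` and `β`
    ∃ A : (ε δ : ℝ) → (n w : ℕ) → ActiveLearner d w,
      (∀ (ε δ : ℝ) (n w : ℕ) (x : Fin w → Inst d) (y : Fin w → Bool),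
        (A ε δ n w x).numRequests y ≤ n) ∧
      -- the label complexity and the pool size
      (∀ α : ℝ, 0 < α → α < 1 → ∃ (K : ℝ) (m : ℕ), 0 < K ∧
        ∀ ε δ β : ℝ, 0 < ε → ε < 1 / 2 → 0 < δ → δ < 1 / 2 → 2 * ε < α →
          1 / Real.log (1 / ε) ^ 2 ≤ β → β ≤ Real.log (1 / ε) → α * β ≤ d →
          ∀ n w : ℕ,
            K * (Real.log (1 / ε) * Real.log (1 / δ)) ^ m *
              (1 / ε) ^ ((2 * α + d - α * β) / (α * (β + 1))) ≤ n →
            K * (Real.log (1 / ε) * Real.log (1 / δ)) ^ m *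
              (1 / ε) ^ ((2 * α + d) / (α * (β + 1))) ≤ w →
            ∀ (𝒳 : Set (Inst d)) (P : Measure (Inst d × Bool)) (η : Inst d → ℝ),
              SmoothNoiseClass 𝒳 α L β C P η → ExcessRiskBound (A ε δ n w) P η ε δ) ∧
      -- the same as a rate in `n`
      (∀ α β : ℝ, 0 < α → α < 1 → 0 < β → α * β ≤ d → ∃ (K : ℝ) (m : ℕ), 0 < K ∧
        ∀ δ : ℝ, 0 < δ → δ < 1 / 2 → ∃ N : ℕ, ∀ n : ℕ, N ≤ n →
          ∃ ε : ℝ, 0 < ε ∧ ε < 1 / 2 ∧ ∃ W : ℕ, ∀ w : ℕ, W ≤ w →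
            ∀ (𝒳 : Set (Inst d)) (P : Measure (Inst d × Bool)) (η : Inst d → ℝ),
              SmoothNoiseClass 𝒳 α L β C P η →
                ExcessRiskBound (A ε δ n w) P η
                  (K * Real.log n ^ m *
                    (n : ℝ) ^ (-(α * (β + 1) / (2 * α + d - α * β)))) δ) := by
  refine ⟨fun ε δ n w => (schedule C ε δ n w).learner d,
    fun ε δ n w x y => Schedule.numRequests_learner_le _ x y, fun α hα hα1 => ?_,
    fun α β hα hα1 hβ hαβ => ?_⟩
  · obtain ⟨K, hK, h⟩ := exists_sampleComplexity hd hL hC hα hα1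
    refine ⟨K, 5, hK, fun ε δ β hε hε2 hδ hδ2 _ hβ _ hαβ n w hn hw 𝒳 P η hP => ?_⟩
    have hlog : 0 < Real.log (1 / ε) := Real.log_pos (by rw [lt_div_iff₀ hε]; linarith)
    exact h ε δ β hε hε2 hδ hδ2 (lt_of_lt_of_le (by positivity) hβ) hαβ n w hn hw 𝒳 P η hP
  · obtain ⟨K₁, hK₁, h⟩ := exists_sampleComplexity hd hL hC hα hα1
    have hE : 0 < (2 * α + d - α * β) / (α * (β + 1)) :=
      div_pos (by linarith) (by positivity)
    obtain ⟨K, m, hK, hacc⟩ := exists_accuracy hK₁ hE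
    refine ⟨K, m, hK, fun δ hδ hδ2 => ?_⟩
    obtain ⟨N, hN⟩ := hacc δ hδ (by linarith)
    refine ⟨N, fun n hn => ?_⟩
    obtain ⟨ε, hε, hε2, hle, hrate⟩ := hN n hn
    rw [one_div_div] at hrate
    refine ⟨ε, hε, hε2, ⌈K₁ * (Real.log (1 / ε) * Real.log (1 / δ)) ^ 5 *
      (1 / ε) ^ ((2 * α + d) / (α * (β + 1)))⌉₊, fun w hw 𝒳 P η hP => ?_⟩
    exact (h ε δ β hε hε2 hδ hδ2 hβ hαβ n w hle (Nat.ceil_le.1 hw) 𝒳 P η hP).mono hrate
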